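/- Let $A$ be a Hopf algebra over $\mathbb{C}$ with coproduct $\Delta$ and counit $\epsilon$, and let $(E,d)$ be a bicovariant first order differential calculus over $A$: $E$ is an $A$-bimodule, $d:A\to E$ is a $\mathbb{C}$-linear map with $d(ab)=(da)b+a\,db$, every element of $E$ is a finite sum $\sum_k a_k\,db_k$, and $\sum_k a_k\,db_k=0$ implies both $\sum_k\Delta(a_k)(\mathrm{id}\otimes d)\Delta(b_k)=0$ and $\sum_k\Delta(a_k)(d\otimes\mathrm{id})\Delta(b_k)=0$. Let $\Delta_E:E\to A\otimes E$ and ${}_E\Delta:E\to E\otimes A$ be the resulting left and right coactions, $\Delta_E(a\,db)=\Delta(a)(\mathrm{id}\otimes d)\Delta(b)$ and ${}_E\Delta(a\,db)=\Delta(a)(d\otimes\mathrm{id})\Delta(b)$, and let $E\otimes_A E$ carry the induced diagonal coactions. Let ${}_0E=\{\omega\in E:\Delta_E(\omega)=1\otimes\omega\}$ and $E_0=\{\eta\in E:{}_E\Delta(\eta)=\eta\otimes1\}$, and assume that both are finite-dimensional. The space ${}_0E\otimes_{\mathbb C}{}_0E$ is identified with the space of left-invariant elements of $E\otimes_AE$.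 Let $\sigma:E\otimes_AE\to E\otimes_AE$ be the canonical braiding, that is, the unique $A$-bimodule map with $\sigma(\omega\otimes\eta)=\eta\otimes\omega$ for all $\omega\in{}_0E$, $\eta\in E_0$; let ${}_0\sigma$ be its restriction to ${}_0E\otimes_{\mathbb C}{}_0E$. Let $\Omega^2=(E\otimes_AE)/\mathrm{Ker}(\sigma-1)$ with quotient map $\wedge$, and let $d:E\to\Omega^2$ be the unique linear map with $d\circ d=0$, $d(a\rho)=da\wedge\rho+a\,d\rho$ and $d(\rho a)=(d\rho)a-\rho\wedge da$. Let ${}_0E\otimes^{\mathrm{sym}}{}_0E$ be the space of elements of ${}_0E\otimes_{\mathbb C}{}_0E$ that lie in $\mathrm{Ker}(\wedge)$; it is the eigenspace of ${}_0\sigma$ for the eigenvalue $1$. Assume that ${}_0\sigma$ is diagonalisable, and let $P$ be the idempotent on ${}_0E\otimes_{\mathbb C}{}_0E$ whose range is ${}_0E\otimes^{\mathrm{sym}}{}_0E$ and whose kernel is the sum of the eigenspaces of ${}_0\sigma$ for the eigenvalues $\lambda\neq1$. Let $g:E\otimes_AE\to A$ be a bi-invariant pseudo-Riemannian metric: $g$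 is right $A$-linear, $g\circ\sigma=g$, if $g(\rho\otimes\nu)=0$ for all $\nu\in E$ then $\rho=0$, and $(\mathrm{id}\otimes\epsilon g)\Delta_{E\otimes_AE}=g=(\epsilon g\otimes\mathrm{id})\,{}_{E\otimes_AE}\Delta$; in particular $g(\omega\otimes\omega')\in\mathbb{C}1$ for $\omega,\omega'\in{}_0E$. Define $$\widetilde{\Phi_g}:\mathrm{Hom}_{\mathbb C}({}_0E,{}_0E\otimes^{\mathrm{sym}}{}_0E)\to\mathrm{Hom}_{\mathbb C}({}_0E\otimes^{\mathrm{sym}}{}_0E,{}_0E),\qquad \widetilde{\Phi_g}(L)=2(\mathrm{id}\otimes g)({}_0\sigma\otimes\mathrm{id})(L\otimes\mathrm{id})P .$$ A (right) connection on $E$ is a $\mathbb{C}$-linear map $\nabla:E\to E\otimes_AE$ with $\nabla(\rho a)=\nabla(\rho)a+\rho\otimes da$ for $\rho\in E$, $a\in A$. It is left-covariant if $(\mathrm{id}\otimes\nabla)\Delta_E=\Delta_{E\otimes_AE}\nabla$ (then $\nabla({}_0E)\subseteq{}_0E\otimes_{\mathbb C}{}_0E$), and torsionless if $\wedge\circ\nabla+d=0$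 on $E$. A left-covariant connection $\nabla$ is compatible with $g$ if $\widetilde{\Pi_g}(\nabla)=d\circ g$ on $E\otimes_AE$, where $\widetilde{\Pi_g}(\nabla):E\otimes_AE\to E$ is the linear map given by $$\widetilde{\Pi_g}(\nabla)(xa)=2(\mathrm{id}\otimes g)({}_0\sigma\otimes\mathrm{id})(\nabla\otimes\mathrm{id})P(x)\,a+g(x)\,da,\qquad x\in{}_0E\otimes_{\mathbb C}{}_0E,\ a\in A .$$ If $\widetilde{\Phi_g}$ is an isomorphism of vector spaces, then there exists a unique left-covariant connection on $E$ that is torsionless and compatible with $g$. -/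

import Mathlib

open scoped TensorProduct

set_option linter.unusedSectionVars false

noncomputable section

namespace QuantumCalculus

/-! Throughout, `A` is a complex Hopf algebra and `E` an `A`-bimodule: a left module over `A` and
over `Aᵐᵒᵖ` (the right action `ρ a` is `MulOpposite.op a • ρ`), the two actions commuting and
being compatible with the complex vector space structure. -/

variable (A : Type*) [Ring A] [HopfAlgebra ℂ A]
variable (E : Type*) [AddCommGroup E] [Module ℂ E] [Module A E] [Module Aᵐᵒᵖ E]
  [SMulCommClass A Aᵐᵒᵖ E] [IsScalarTower ℂ A E] [IsScalarTower ℂ Aᵐᵒᵖ E]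

/-- Left multiplication `a, ρ ↦ a ρ`. -/
def lmul : A →ₗ[ℂ] E →ₗ[ℂ] E := (Algebra.lsmul ℂ ℂ E).toLinearMap

/-- Right multiplication `a, ρ ↦ ρ a`. -/
def rmul : A →ₗ[ℂ] E →ₗ[ℂ] E :=
  (Algebra.lsmul ℂ ℂ E : Aᵐᵒᵖ →ₐ[ℂ] Module.End ℂ E).toLinearMap ∘ₗ
    (MulOpposite.opLinearEquiv ℂ : A ≃ₗ[ℂ] Aᵐᵒᵖ).toLinearMap

@[simp] lemma lmul_apply (a : A) (ρ : E) : lmul A E a ρ = a • ρ := rfl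

@[simp] lemma rmul_apply (a : A) (ρ : E) : rmul A E a ρ = MulOpposite.op a • ρ := rfl

/-! ### Actions of `A ⊗ A` on `A ⊗ E` and on `E ⊗ A`, factor by factor -/

/-- `(a ⊗ b) (c ⊗ ρ) = a c ⊗ b ρ`. -/
def lmulAE : A ⊗[ℂ] A →ₗ[ℂ] A ⊗[ℂ] E →ₗ[ℂ] A ⊗[ℂ] E :=
  TensorProduct.map₂ (LinearMap.mul ℂ A) (lmul A E)

/-- `(c ⊗ ρ) (a ⊗ b) = c a ⊗ ρ b`, with the acting element as first argument. -/
def rmulAE : A ⊗[ℂ] A →ₗ[ℂ] A ⊗[ℂ] E →ₗ[ℂ] A ⊗[ℂ] E :=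
  TensorProduct.map₂ (LinearMap.mul ℂ A).flip (rmul A E)

/-- `(a ⊗ b) (ρ ⊗ c) = a ρ ⊗ b c`. -/
def lmulEA : A ⊗[ℂ] A →ₗ[ℂ] E ⊗[ℂ] A →ₗ[ℂ] E ⊗[ℂ] A :=
  TensorProduct.map₂ (lmul A E) (LinearMap.mul ℂ A)

/-- `(ρ ⊗ c) (a ⊗ b) = ρ a ⊗ c b`, with the acting element as first argument. -/
def rmulEA : A ⊗[ℂ] A →ₗ[ℂ] E ⊗[ℂ] A →ₗ[ℂ] E ⊗[ℂ] A :=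
  TensorProduct.map₂ (rmul A E) (LinearMap.mul ℂ A).flip

/-! ### Bicovariant first order differential calculi -/

/-- A first order differential calculus over `A` with bimodule of one-forms `E`. -/
structure FirstOrderCalculus where
  d : A →ₗ[ℂ] E
  leibniz : ∀ a b : A, d (a * b) = MulOpposite.op b • d a + a • d b
  exists_sum : ∀ ρ : E, ∃ (n : ℕ) (a b : Fin n → A), ρ = ∑ k, a k • d (b k)

/-- A bicovariant first order differential calculus over the Hopf algebra `A`. -/
structure BicovariantCalculus extends FirstOrderCalculus A E where
  left_covariant : ∀ (n : ℕ) (a b : Fin n → A), ∑ k, a k • d (b k) = 0 →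
    ∑ k, lmulAE A E (Coalgebra.comul (a k)) (d.lTensor A (Coalgebra.comul (b k))) = 0
  right_covariant : ∀ (n : ℕ) (a b : Fin n → A), ∑ k, a k • d (b k) = 0 →
    ∑ k, lmulEA A E (Coalgebra.comul (a k)) (d.rTensor A (Coalgebra.comul (b k))) = 0

variable {A E}

namespace BicovariantCalculus

variable (D : BicovariantCalculus A E)

/-! ### The coactions on `E` -/

/-- `a ⊗ b ↦ a db`. -/
def formMap : A ⊗[ℂ] A →ₗ[ℂ] E :=
  TensorProduct.lift ((lmul A E).compl₂ D.d)

/-- `a ⊗ b ↦ Δ(a) (id ⊗ d) Δ(b)`. -/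
def preCoactL : A ⊗[ℂ] A →ₗ[ℂ] A ⊗[ℂ] E :=
  TensorProduct.lift ((lmulAE A E).compl₁₂ Coalgebra.comul (D.d.lTensor A ∘ₗ Coalgebra.comul))

/-- `a ⊗ b ↦ Δ(a) (d ⊗ id) Δ(b)`. -/
def preCoactR : A ⊗[ℂ] A →ₗ[ℂ] E ⊗[ℂ] A :=
  TensorProduct.lift ((lmulEA A E).compl₁₂ Coalgebra.comul (D.d.rTensor A ∘ₗ Coalgebra.comul))

@[simp] lemma formMap_tmul (a b : A) : D.formMap (a ⊗ₜ b) = a • D.d b := rfl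

@[simp] lemma preCoactL_tmul (a b : A) : D.preCoactL (a ⊗ₜ b) =
    lmulAE A E (Coalgebra.comul a) (D.d.lTensor A (Coalgebra.comul b)) := rfl

@[simp] lemma preCoactR_tmul (a b : A) : D.preCoactR (a ⊗ₜ b) =
    lmulEA A E (Coalgebra.comul a) (D.d.rTensor A (Coalgebra.comul b)) := rfl

lemma exists_fin_sum (x : A ⊗[ℂ] A) :
    ∃ (n : ℕ) (a b : Fin n → A), x = ∑ k, a k ⊗ₜ[ℂ] b k := by
  obtain ⟨S, rfl⟩ := TensorProduct.exists_finset x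
  refine ⟨S.card, fun k => (S.equivFin.symm k).1.1, fun k => (S.equivFin.symm k).1.2, ?_⟩
  rw [← Finset.sum_coe_sort S]
  exact (Equiv.sum_comp S.equivFin.symm (fun i => i.1.1 ⊗ₜ[ℂ] i.1.2)).symm

lemma formMap_surjective : Function.Surjective D.formMap := fun ρ => by
  obtain ⟨n, a, b, rfl⟩ := D.exists_sum ρ
  exact ⟨∑ k, a k ⊗ₜ b k, by simp⟩

lemma ker_formMap_le_left : LinearMap.ker D.formMap ≤ LinearMap.ker D.preCoactL := fun x hx => by
  obtain ⟨n, a, b, rfl⟩ := exists_fin_sum x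
  simpa using D.left_covariant n a b (by simpa using hx)

lemma ker_formMap_le_right : LinearMap.ker D.formMap ≤ LinearMap.ker D.preCoactR := fun x hx => by
  obtain ⟨n, a, b, rfl⟩ := exists_fin_sum x
  simpa using D.right_covariant n a b (by simpa using hx)

/-- The left coaction `Δ_E`, determined by `Δ_E (a db) = Δ(a) (id ⊗ d) Δ(b)`. -/
def coactL : E →ₗ[ℂ] A ⊗[ℂ] E :=
  (LinearMap.ker D.formMap).liftQ D.preCoactL D.ker_formMap_le_left ∘ₗ
    (D.formMap.quotKerEquivOfSurjective D.formMap_surjective).symm.toLinearMap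

/-- The right coaction `_EΔ`, determined by `_EΔ (a db) = Δ(a) (d ⊗ id) Δ(b)`. -/
def coactR : E →ₗ[ℂ] E ⊗[ℂ] A :=
  (LinearMap.ker D.formMap).liftQ D.preCoactR D.ker_formMap_le_right ∘ₗ
    (D.formMap.quotKerEquivOfSurjective D.formMap_surjective).symm.toLinearMap

lemma coactL_formMap (x : A ⊗[ℂ] A) : D.coactL (D.formMap x) = D.preCoactL x := by
  have : (D.formMap.quotKerEquivOfSurjective D.formMap_surjective).symm (D.formMap x) =
      (LinearMap.ker D.formMap).mkQ x := by
    rw [LinearEquiv.symm_apply_eq]; rfl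
  simp [coactL, this]

lemma coactR_formMap (x : A ⊗[ℂ] A) : D.coactR (D.formMap x) = D.preCoactR x := by
  have : (D.formMap.quotKerEquivOfSurjective D.formMap_surjective).symm (D.formMap x) =
      (LinearMap.ker D.formMap).mkQ x := by
    rw [LinearEquiv.symm_apply_eq]; rfl
  simp [coactR, this]

lemma lmulAE_mul (x y : A ⊗[ℂ] A) (z : A ⊗[ℂ] E) :
    lmulAE A E (x * y) z = lmulAE A E x (lmulAE A E y z) := by
  induction z with
  | zero => simp
  | add u v hu hv => simp [hu, hv]
  | tmul c ρ =>
    induction x with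
    | zero => simp
    | add u v hu hv => simp [add_mul, hu, hv]
    | tmul a b =>
      induction y with
      | zero => simp
      | add u v hu hv => simp [mul_add, hu, hv]
      | tmul a' b' => simp [lmulAE, mul_assoc, mul_smul]

lemma lmulEA_mul (x y : A ⊗[ℂ] A) (z : E ⊗[ℂ] A) :
    lmulEA A E (x * y) z = lmulEA A E x (lmulEA A E y z) := by
  induction z with
  | zero => simp
  | add u v hu hv => simp [hu, hv]
  | tmul c ρ =>
    induction x with
    | zero => simp
    | add u v hu hv => simp [add_mul, hu, hv]
    | tmul a b =>
      induction y with
      | zero => simp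
      | add u v hu hv => simp [mul_add, hu, hv]
      | tmul a' b' => simp [lmulEA, mul_assoc, mul_smul]

lemma rmul_lmulAE (x y : A ⊗[ℂ] A) (z : A ⊗[ℂ] E) :
    rmulAE A E y (lmulAE A E x z) = lmulAE A E x (rmulAE A E y z) := by
  induction z with
  | zero => simp
  | add u v hu hv => simp [hu, hv]
  | tmul c ρ =>
    induction x with
    | zero => simp
    | add u v hu hv => simp [hu, hv]
    | tmul a b =>
      induction y with
      | zero => simp
      | add u v hu hv => simp [hu, hv]
      | tmul a' b' => simp [lmulAE, rmulAE, mul_assoc, smul_comm]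

lemma rmul_lmulEA (x y : A ⊗[ℂ] A) (z : E ⊗[ℂ] A) :
    rmulEA A E y (lmulEA A E x z) = lmulEA A E x (rmulEA A E y z) := by
  induction z with
  | zero => simp
  | add u v hu hv => simp [hu, hv]
  | tmul c ρ =>
    induction x with
    | zero => simp
    | add u v hu hv => simp [hu, hv]
    | tmul a b =>
      induction y with
      | zero => simp
      | add u v hu hv => simp [hu, hv]
      | tmul a' b' => simp [lmulEA, rmulEA, mul_assoc, smul_comm]

lemma lTensor_d_mul (x y : A ⊗[ℂ] A) : D.d.lTensor A (x * y) =
    rmulAE A E y (D.d.lTensor A x) + lmulAE A E x (D.d.lTensor A y) := by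
  induction x with
  | zero => simp
  | add u v hu hv => simp only [add_mul, map_add, hu, hv, LinearMap.add_apply]; abel
  | tmul a b =>
    induction y with
    | zero => simp
    | add u v hu hv => simp only [mul_add, map_add, hu, hv, LinearMap.add_apply]; abel
    | tmul a' b' => simp [lmulAE, rmulAE, D.leibniz, TensorProduct.tmul_add]

lemma rTensor_d_mul (x y : A ⊗[ℂ] A) : D.d.rTensor A (x * y) =
    rmulEA A E y (D.d.rTensor A x) + lmulEA A E x (D.d.rTensor A y) := by
  induction x with
  | zero => simp
  | add u v hu hv => simp only [add_mul, map_add, hu, hv, LinearMap.add_apply]; abel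
  | tmul a b =>
    induction y with
    | zero => simp
    | add u v hu hv => simp only [mul_add, map_add, hu, hv, LinearMap.add_apply]; abel
    | tmul a' b' => simp [lmulEA, rmulEA, D.leibniz, TensorProduct.add_tmul]

lemma coactL_form (a b : A) : D.coactL (a • D.d b) =
    lmulAE A E (Coalgebra.comul a) (D.d.lTensor A (Coalgebra.comul b)) :=
  D.coactL_formMap (a ⊗ₜ b)

lemma coactR_form (a b : A) : D.coactR (a • D.d b) =
    lmulEA A E (Coalgebra.comul a) (D.d.rTensor A (Coalgebra.comul b)) :=
  D.coactR_formMap (a ⊗ₜ b)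

lemma form_mul (a b c : A) : MulOpposite.op c • a • D.d b =
    a • D.d (b * c) - (a * b) • D.d c := by
  rw [D.leibniz, smul_add, mul_smul, add_sub_cancel_right, smul_comm a]

lemma coactL_smul (a : A) (ρ : E) :
    D.coactL (a • ρ) = lmulAE A E (Coalgebra.comul a) (D.coactL ρ) := by
  obtain ⟨n, b, c, rfl⟩ := D.exists_sum ρ
  simp only [Finset.smul_sum, map_sum]
  refine Finset.sum_congr rfl fun k _ => ?_
  rw [smul_smul, coactL_form, coactL_form, Bialgebra.comul_mul, lmulAE_mul]

lemma coactR_smul (a : A) (ρ : E) :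
    D.coactR (a • ρ) = lmulEA A E (Coalgebra.comul a) (D.coactR ρ) := by
  obtain ⟨n, b, c, rfl⟩ := D.exists_sum ρ
  simp only [Finset.smul_sum, map_sum]
  refine Finset.sum_congr rfl fun k _ => ?_
  rw [smul_smul, coactR_form, coactR_form, Bialgebra.comul_mul, lmulEA_mul]

lemma coactL_op_smul (a : A) (ρ : E) :
    D.coactL (MulOpposite.op a • ρ) = rmulAE A E (Coalgebra.comul a) (D.coactL ρ) := by
  obtain ⟨n, b, c, rfl⟩ := D.exists_sum ρ
  simp only [Finset.smul_sum, map_sum]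
  refine Finset.sum_congr rfl fun k _ => ?_
  rw [form_mul, map_sub, coactL_form, coactL_form, coactL_form, Bialgebra.comul_mul,
    Bialgebra.comul_mul, lTensor_d_mul, map_add, lmulAE_mul, add_sub_cancel_right, rmul_lmulAE]

lemma coactR_op_smul (a : A) (ρ : E) :
    D.coactR (MulOpposite.op a • ρ) = rmulEA A E (Coalgebra.comul a) (D.coactR ρ) := by
  obtain ⟨n, b, c, rfl⟩ := D.exists_sum ρ
  simp only [Finset.smul_sum, map_sum]
  refine Finset.sum_congr rfl fun k _ => ?_
  rw [form_mul, map_sub, coactR_form, coactR_form, coactR_form, Bialgebra.comul_mul,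
    Bialgebra.comul_mul, rTensor_d_mul, map_add, lmulEA_mul, add_sub_cancel_right, rmul_lmulEA]

/-- `₀E`, the left-invariant one-forms. -/
def leftInv : Submodule ℂ E :=
  LinearMap.eqLocus D.coactL (TensorProduct.mk ℂ A E 1)

/-- `E₀`, the right-invariant one-forms. -/
def rightInv : Submodule ℂ E :=
  LinearMap.eqLocus D.coactR ((TensorProduct.mk ℂ E A).flip 1)

end BicovariantCalculus

/-! ### The tensor product `E ⊗_A E` over the noncommutative algebra `A` -/

variable (A E)

/-- The span of all `ρ a ⊗ ν - ρ ⊗ a ν` in `E ⊗_ℂ E`. -/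
def balancing : Submodule ℂ (E ⊗[ℂ] E) :=
  Submodule.span ℂ {z | ∃ (ρ ν : E) (a : A),
    z = (MulOpposite.op a • ρ) ⊗ₜ[ℂ] ν - ρ ⊗ₜ[ℂ] (a • ν)}

/-- `E ⊗_A E`, as a complex vector space; see `lmulT` and `rmulT` for its bimodule structure. -/
abbrev TensorSq : Type _ := (E ⊗[ℂ] E) ⧸ balancing A E

/-- `ρ, ν ↦ ρ ⊗_A ν`. -/
def tmulA : E →ₗ[ℂ] E →ₗ[ℂ] TensorSq A E :=
  (TensorProduct.mk ℂ E E).compr₂ (balancing A E).mkQ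

lemma tmulA_balanced (a : A) (ρ ν : E) :
    tmulA A E (MulOpposite.op a • ρ) ν = tmulA A E ρ (a • ν) :=
  (Submodule.Quotient.eq _).2 (Submodule.subset_span ⟨ρ, ν, a, rfl⟩)

variable {A E} in
/-- A balanced bilinear map on `E × E` induces a linear map on `E ⊗_A E`. -/
def liftA {W : Type*} [AddCommGroup W] [Module ℂ W] (f : E →ₗ[ℂ] E →ₗ[ℂ] W)
    (hf : ∀ (a : A) (ρ ν : E), f (MulOpposite.op a • ρ) ν = f ρ (a • ν)) :
    TensorSq A E →ₗ[ℂ] W :=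
  (balancing A E).liftQ (TensorProduct.lift f) <| Submodule.span_le.2 <| by
    rintro _ ⟨ρ, ν, a, rfl⟩
    simp [hf]

variable {A E} in
@[simp] lemma liftA_tmulA {W : Type*} [AddCommGroup W] [Module ℂ W] (f : E →ₗ[ℂ] E →ₗ[ℂ] W)
    (hf : ∀ (a : A) (ρ ν : E), f (MulOpposite.op a • ρ) ν = f ρ (a • ν)) (ρ ν : E) :
    liftA f hf (tmulA A E ρ ν) = f ρ ν := rfl

/-- Left multiplication on `E ⊗_A E`: `a (ρ ⊗ ν) = a ρ ⊗ ν`. -/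
def lmulT (a : A) : TensorSq A E →ₗ[ℂ] TensorSq A E :=
  liftA ((tmulA A E).compl₁₂ (lmul A E a) LinearMap.id) fun b ρ ν => by
    simp [← tmulA_balanced, smul_comm]

/-- Right multiplication on `E ⊗_A E`: `(ρ ⊗ ν) a = ρ ⊗ ν a`. -/
def rmulT (a : A) : TensorSq A E →ₗ[ℂ] TensorSq A E :=
  liftA ((tmulA A E).compl₁₂ LinearMap.id (rmul A E a)) fun b ρ ν => by
    simp [tmulA_balanced, smul_comm]

variable {A E}

namespace BicovariantCalculus

variable (D : BicovariantCalculus A E)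

/-- `(a ⊗ ρ, b ⊗ ν) ↦ a b ⊗ (ρ ⊗_A ν)`. -/
def pairL : A ⊗[ℂ] E →ₗ[ℂ] A ⊗[ℂ] E →ₗ[ℂ] A ⊗[ℂ] TensorSq A E :=
  TensorProduct.map₂ (LinearMap.mul ℂ A) (tmulA A E)

/-- `(ρ ⊗ a, ν ⊗ b) ↦ (ρ ⊗_A ν) ⊗ a b`. -/
def pairR : E ⊗[ℂ] A →ₗ[ℂ] E ⊗[ℂ] A →ₗ[ℂ] TensorSq A E ⊗[ℂ] A :=
  TensorProduct.map₂ (tmulA A E) (LinearMap.mul ℂ A)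

lemma pairL_balanced (x : A ⊗[ℂ] A) (y z : A ⊗[ℂ] E) :
    pairL (rmulAE A E x y) z = pairL y (lmulAE A E x z) := by
  induction z with
  | zero => simp
  | add u v hu hv => simp [hu, hv]
  | tmul c ρ =>
    induction x with
    | zero => simp
    | add u v hu hv => simp [hu, hv]
    | tmul a b =>
      induction y with
      | zero => simp
      | add u v hu hv => simp [hu, hv]
      | tmul a' b' => simp [pairL, lmulAE, rmulAE, mul_assoc, tmulA_balanced]

lemma pairR_balanced (x : A ⊗[ℂ] A) (y z : E ⊗[ℂ] A) :
    pairR (rmulEA A E x y) z = pairR y (lmulEA A E x z) := by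
  induction z with
  | zero => simp
  | add u v hu hv => simp [hu, hv]
  | tmul c ρ =>
    induction x with
    | zero => simp
    | add u v hu hv => simp [hu, hv]
    | tmul a b =>
      induction y with
      | zero => simp
      | add u v hu hv => simp [hu, hv]
      | tmul a' b' => simp [pairR, lmulEA, rmulEA, mul_assoc, tmulA_balanced]

/-- The left coaction on `E ⊗_A E`: `ρ ⊗ ν ↦ ρ₍₋₁₎ ν₍₋₁₎ ⊗ (ρ₍₀₎ ⊗ ν₍₀₎)`. -/
def coactLT : TensorSq A E →ₗ[ℂ] A ⊗[ℂ] TensorSq A E :=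
  liftA (pairL.compl₁₂ D.coactL D.coactL) fun a ρ ν => by
    simp [coactL_smul, coactL_op_smul, pairL_balanced]

/-- The right coaction on `E ⊗_A E`: `ρ ⊗ ν ↦ (ρ₍₀₎ ⊗ ν₍₀₎) ⊗ ρ₍₁₎ ν₍₁₎`. -/
def coactRT : TensorSq A E →ₗ[ℂ] TensorSq A E ⊗[ℂ] A :=
  liftA (pairR.compl₁₂ D.coactR D.coactR) fun a ρ ν => by
    simp [coactR_smul, coactR_op_smul, pairR_balanced]

/-! ### The braiding, two-forms, and the exterior derivative of one-forms -/

/-- `s` is a bimodule endomorphism of `E ⊗_A E` with `s (ω ⊗ η) = η ⊗ ω` for every left-invariant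
`ω` and every right-invariant `η`. -/
structure IsBraiding (s : TensorSq A E →ₗ[ℂ] TensorSq A E) : Prop where
  map_lmul : ∀ (a : A) (x : TensorSq A E), s (lmulT A E a x) = lmulT A E a (s x)
  map_rmul : ∀ (a : A) (x : TensorSq A E), s (rmulT A E a x) = rmulT A E a (s x)
  swap : ∀ ω ∈ D.leftInv, ∀ η ∈ D.rightInv, s (tmulA A E ω η) = tmulA A E η ω

/-- The canonical braiding `σ` of `E ⊗_A E`: the unique map satisfying `IsBraiding`. -/
def braiding : TensorSq A E →ₗ[ℂ] TensorSq A E := Classical.epsilon D.IsBraiding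

/-- The two-forms `Ω² = (E ⊗_A E) / Ker (σ - 1)`. -/
abbrev TwoForms : Type _ := TensorSq A E ⧸ LinearMap.ker (D.braiding - LinearMap.id)

/-- The quotient map `∧ : E ⊗_A E → Ω²`. -/
def wedge : TensorSq A E →ₗ[ℂ] D.TwoForms :=
  (LinearMap.ker (D.braiding - LinearMap.id)).mkQ

/-- `δ : E → Ω²` extends `d` as a differential: `δ ∘ d = 0`, and `δ` satisfies the graded Leibniz
rules for products of a function and a one-form. Here `a (∧ x) = ∧ (a x)`, `(∧ x) a = ∧ (x a)`,
so the products of the two-form `δ ρ` with `a` are formed with any `x` such that `∧ x = δ ρ`. -/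
structure IsExteriorDerivative (δ : E →ₗ[ℂ] D.TwoForms) : Prop where
  d_d : ∀ a : A, δ (D.d a) = 0
  left_leibniz : ∀ (a : A) (ρ : E) (x : TensorSq A E), D.wedge x = δ ρ →
    δ (a • ρ) = D.wedge (tmulA A E (D.d a) ρ) + D.wedge (lmulT A E a x)
  right_leibniz : ∀ (a : A) (ρ : E) (x : TensorSq A E), D.wedge x = δ ρ →
    δ (MulOpposite.op a • ρ) = D.wedge (rmulT A E a x) - D.wedge (tmulA A E ρ (D.d a))

/-- The differential `d : E → Ω²`: the unique map satisfying `IsExteriorDerivative`. -/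
def dOne : E →ₗ[ℂ] D.TwoForms := Classical.epsilon D.IsExteriorDerivative

/-! ### Left-invariant two-tensors, `₀σ`, symmetric tensors and the symmetrisation -/

/-- `₀E ⊗_ℂ ₀E`. -/
abbrev InvSq : Type _ := D.leftInv ⊗[ℂ] D.leftInv

/-- The canonical map `₀E ⊗_ℂ ₀E → E ⊗_A E`, `ω ⊗ ω' ↦ ω ⊗_A ω'`. It is injective, and its range
consists of the left-invariant elements of `E ⊗_A E`. -/
def invSqMap : D.InvSq →ₗ[ℂ] TensorSq A E :=
  TensorProduct.lift ((tmulA A E).compl₁₂ D.leftInv.subtype D.leftInv.subtype)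

/-- A linear map with left-invariant values in `E ⊗_A E`, regarded as a map into `₀E ⊗_ℂ ₀E`
through the identification `invSqMap`: the unique `F` with `invSqMap ∘ F = f`. -/
def toInvSq {W : Type*} [AddCommGroup W] [Module ℂ W] (f : W →ₗ[ℂ] TensorSq A E) :
    W →ₗ[ℂ] D.InvSq :=
  Classical.epsilon fun F : W →ₗ[ℂ] D.InvSq => D.invSqMap ∘ₗ F = f

/-- `₀σ : ₀E ⊗_ℂ ₀E → ₀E ⊗_ℂ ₀E`, the restriction of the braiding. -/
def braiding₀ : Module.End ℂ D.InvSq := D.toInvSq (D.braiding ∘ₗ D.invSqMap)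

/-- `₀σ` is diagonalisable: `₀E ⊗_ℂ ₀E` is the sum of the eigenspaces of `₀σ`. -/
def Diagonalisable : Prop := ⨆ μ : ℂ, D.braiding₀.eigenspace μ = ⊤

/-- `₀E ⊗^sym ₀E`: the left-invariant two-tensors in the kernel of `∧`. -/
def symSq : Submodule ℂ D.InvSq := LinearMap.ker (D.wedge ∘ₗ D.invSqMap)

/-- `₀F`, the sum of the eigenspaces of `₀σ` for the eigenvalues other than `1`. -/
def antiSq : Submodule ℂ D.InvSq := ⨆ (μ : ℂ) (_ : μ ≠ 1), D.braiding₀.eigenspace μ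

variable {D} in
lemma Diagonalisable.isCompl (h : D.Diagonalisable) :
    IsCompl (D.braiding₀.eigenspace 1) D.antiSq := by
  refine ⟨D.braiding₀.eigenspaces_iSupIndep 1, codisjoint_iff.2 (top_unique ?_)⟩
  rw [← h]
  refine iSup_le fun μ => ?_
  by_cases hμ : μ = 1
  · subst hμ; exact le_sup_left
  · exact le_sup_of_le_right (le_iSup₂_of_le μ hμ le_rfl)

/-- `₀(P_sym)`: the idempotent of `₀E ⊗_ℂ ₀E` with range the eigenspace of `₀σ` for the
eigenvalue `1` (which is `₀E ⊗^sym ₀E`) and with kernel `₀F`. -/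
def psym₀ (h : D.Diagonalisable) : D.InvSq →ₗ[ℂ] D.InvSq :=
  Submodule.projection _ _ h.isCompl

/-! ### Metrics -/

/-- `g : E ⊗_A E → A` is a pseudo-Riemannian metric. -/
structure IsMetric (g : TensorSq A E →ₗ[ℂ] A) : Prop where
  map_rmul : ∀ (a : A) (x : TensorSq A E), g (rmulT A E a x) = g x * a
  symm : ∀ x : TensorSq A E, g (D.braiding x) = g x
  nondegenerate : ∀ ρ : E, (∀ ν : E, g (tmulA A E ρ ν) = 0) → ρ = 0

/-- `g` is left-invariant and right-invariant:
`(id ⊗ ε g) Δ (ρ ⊗ ν) = g (ρ ⊗ ν) = (ε g ⊗ id) Δ (ρ ⊗ ν)` for the left, respectively the right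
coaction on `E ⊗_A E`. -/
structure IsBiinvariant (g : TensorSq A E →ₗ[ℂ] A) : Prop where
  left : ∀ ρ ν : E, TensorProduct.rid ℂ A
    ((Coalgebra.counit ∘ₗ g).lTensor A (D.coactLT (tmulA A E ρ ν))) = g (tmulA A E ρ ν)
  right : ∀ ρ ν : E, TensorProduct.lid ℂ A
    ((Coalgebra.counit ∘ₗ g).rTensor A (D.coactRT (tmulA A E ρ ν))) = g (tmulA A E ρ ν)

/-- The map `id ⊗ g : ₀E ⊗ ₀E ⊗ ₀E → ₀E`. For an invariant metric `g (ω ⊗ ω')` is a scalar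
multiple of `1` for all left-invariant `ω`, `ω'`; that scalar is `ε (g (ω ⊗ ω'))`. -/
def contract (g : TensorSq A E →ₗ[ℂ] A) : D.InvSq ⊗[ℂ] D.leftInv →ₗ[ℂ] D.leftInv :=
  (TensorProduct.rid ℂ D.leftInv).toLinearMap ∘ₗ
    (Coalgebra.counit ∘ₗ g ∘ₗ D.invSqMap).lTensor D.leftInv ∘ₗ
    (TensorProduct.assoc ℂ D.leftInv D.leftInv D.leftInv).toLinearMap

/-- `2 (id ⊗ g) (₀σ ⊗ id) (N ⊗ id) ₀(P_sym)`, for a linear map `N : ₀E → ₀E ⊗ ₀E`. -/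
def twist (h : D.Diagonalisable) (g : TensorSq A E →ₗ[ℂ] A) (N : D.leftInv →ₗ[ℂ] D.InvSq) :
    D.InvSq →ₗ[ℂ] D.leftInv :=
  (2 : ℂ) • (D.contract g ∘ₗ D.braiding₀.rTensor D.leftInv ∘ₗ N.rTensor D.leftInv ∘ₗ D.psym₀ h)

/-- The map `Φ̃_g : Hom(₀E, ₀E ⊗^sym ₀E) → Hom(₀E ⊗^sym ₀E, ₀E)`,
`L ↦ 2 (id ⊗ g) σ₁₂ (L ⊗ id) ₀(P_sym)`. -/
def phi (h : D.Diagonalisable) (g : TensorSq A E →ₗ[ℂ] A) :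
    (D.leftInv →ₗ[ℂ] D.symSq) →ₗ[ℂ] (D.symSq →ₗ[ℂ] D.leftInv) where
  toFun L := D.twist h g (D.symSq.subtype ∘ₗ L) ∘ₗ D.symSq.subtype
  map_add' L M := by
    ext x
    simp [twist, LinearMap.comp_add, LinearMap.rTensor_add]
  map_smul' c L := by
    ext x
    simp [twist, LinearMap.comp_smul, LinearMap.rTensor_smul, smul_comm c]

/-! ### Connections -/

/-- `∇ : E → E ⊗_A E` is a (right) connection: `∇ (ρ a) = (∇ ρ) a + ρ ⊗ da`. -/
def IsConnection (nabla : E →ₗ[ℂ] TensorSq A E) : Prop :=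
  ∀ (ρ : E) (a : A), nabla (MulOpposite.op a • ρ) =
    rmulT A E a (nabla ρ) + tmulA A E ρ (D.d a)

/-- `∇` is left-covariant: `(id ⊗ ∇) Δ_E = Δ_{E ⊗ E} ∇`. -/
def IsLeftCovariant (nabla : E →ₗ[ℂ] TensorSq A E) : Prop :=
  nabla.lTensor A ∘ₗ D.coactL = D.coactLT ∘ₗ nabla

/-- The torsion `∧ ∘ ∇ + d` vanishes. -/
def IsTorsionless (nabla : E →ₗ[ℂ] TensorSq A E) : Prop :=
  D.wedge ∘ₗ nabla + D.dOne = 0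

/-- `Π̃⁰_g(∇) = 2 (id ⊗ g) (σ ⊗ id) (∇ ⊗ id) ₀(P_sym) : ₀E ⊗ ₀E → ₀E`, for a left-covariant
connection `∇` (which maps `₀E` into `₀E ⊗ ₀E`). -/
def piInv (h : D.Diagonalisable) (g : TensorSq A E →ₗ[ℂ] A) (nabla : E →ₗ[ℂ] TensorSq A E) :
    D.InvSq →ₗ[ℂ] D.leftInv :=
  D.twist h g (D.toInvSq (nabla ∘ₗ D.leftInv.subtype))

/-- The multiplication isomorphism `ũ : (₀E ⊗ ₀E) ⊗ A → E ⊗_A E`, `x ⊗ a ↦ x a`, on pairs. -/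
def uTilde (x : D.InvSq) (a : A) : TensorSq A E := rmulT A E a (D.invSqMap x)

/-- `∇` is compatible with `g`, that is `Π̃_g(∇) = d ∘ g` on `E ⊗_A E`, where
`Π̃_g(∇) : E ⊗_A E → E` is given through the isomorphism `ũ` by
`Π̃_g(∇) (ũ (x ⊗ a)) = Π̃⁰_g(∇)(x) a + g(x) da`. -/
def IsCompatible (h : D.Diagonalisable) (g : TensorSq A E →ₗ[ℂ] A)
    (nabla : E →ₗ[ℂ] TensorSq A E) : Prop :=
  ∀ (x : D.InvSq) (a : A),
    MulOpposite.op a • (D.piInv h g nabla x : E) + g (D.invSqMap x) • D.d a =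
      D.d (g (D.uTilde x a))

end BicovariantCalculus

end QuantumCalculus

end

noncomputable section

namespace QuantumCalculus

variable {A : Type*} [Ring A] [HopfAlgebra ℂ A]
variable {E : Type*} [AddCommGroup E] [Module ℂ E] [Module A E] [Module Aᵐᵒᵖ E]
  [SMulCommClass A Aᵐᵒᵖ E] [IsScalarTower ℂ A E] [IsScalarTower ℂ Aᵐᵒᵖ E]

open Coalgebra HopfAlgebra TensorProduct

/-! A left-covariant connection is determined by a linear map `N : ₀E → ₀E ⊗ ₀E`, through `∇(ω a) =
N(ω) a + ω ⊗ da`, and every `N` occurs. In terms of `N` both conditions are affine. Torsion vanishes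
exactly when `∧ N(ω) = -dω` on `₀E`, so the torsionless connections form a translate `N₀ + Hom(₀E,
₀E ⊗^sym ₀E)`. Since `g` has scalar values on `₀E ⊗ ₀E`, `d(g(x a)) = g(x) da`, and compatibility
reduces to `twist N = 0`. Because `twist` ends with the idempotent `P`, this need only be tested on
symmetric tensors, where the condition on `L = N - N₀` reads `Φ̃_g(L) = -twist N₀`. Bijectivity of
`Φ̃_g` gives exactly one such `L`.

Three facts support this reduction.

The braiding, `d` on one-forms and the restrictions to `₀E ⊗ ₀E` enter through choice, so objects
with the required properties must be exhibited. The braiding comes from the projections `ρ ↦ S(ρ₋₁)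
ρ₀` and `ρ ↦ ρ₀ S(ρ₁)` onto invariant forms (`isBraiding_braid`). The rule `a db ↦ da ∧ db` is well
defined because `(σ - 1)(da ⊗ db)` depends only on `a db` (`braiding_dTmulD`).

A torsionless `N₀` exists because the Maurer–Cartan equation places `dω` in `∧(₀E ⊗ ₀E)` for
left-invariant `ω` (`dOne_maurerCartan`, `exists_torsionless`).

The parametrisation by `N` needs `₀E ⊗ A → E`, `ω ⊗ a ↦ ω a`, to be bijective. The antipode is not
assumed bijective, so the usual projection `ρ₀ S⁻¹(ρ₋₁)` is not available; the metric replaces it.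
If `v` is the matrix of the left coaction on `E₀` and `G` the Gram matrix, invariance says `v G vᵀ =
G`, so `vᵀ` has inverse `G⁻¹ v G`, and this inverse turns a basis of `E₀` into a right basis of `E`
made of left-invariant forms (`invForm_mem`, `exists_rightTrivialisation`). -/

/-! ### Elementary rules for the bimodule actions. -/

@[simp] lemma lmulAE_tmul (a b c : A) (ρ : E) :
    lmulAE A E (a ⊗ₜ b) (c ⊗ₜ ρ) = (a * c) ⊗ₜ (b • ρ) := rfl

@[simp] lemma rmulAE_tmul (a b c : A) (ρ : E) :
    rmulAE A E (a ⊗ₜ b) (c ⊗ₜ ρ) = (c * a) ⊗ₜ (MulOpposite.op b • ρ) := rfl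

@[simp] lemma lmulEA_tmul (a b c : A) (ρ : E) :
    lmulEA A E (a ⊗ₜ b) (ρ ⊗ₜ c) = (a • ρ) ⊗ₜ (b * c) := rfl

@[simp] lemma rmulEA_tmul (a b c : A) (ρ : E) :
    rmulEA A E (a ⊗ₜ b) (ρ ⊗ₜ c) = (MulOpposite.op a • ρ) ⊗ₜ (c * b) := rfl

lemma op_smul_complex (c : ℂ) (a : A) (ρ : E) :
    MulOpposite.op (c • a) • ρ = c • MulOpposite.op a • ρ := by
  rw [MulOpposite.op_smul, smul_assoc]

lemma op_algebraMap_smul (c : ℂ) (ρ : E) :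
    MulOpposite.op (algebraMap ℂ A c) • ρ = c • ρ := by
  rw [Algebra.algebraMap_eq_smul_one, op_smul_complex, MulOpposite.op_one, one_smul]

lemma left_smul_complex (c : ℂ) (a : A) (ρ : E) : a • c • ρ = c • a • ρ :=
  (lmul A E a).map_smul c ρ

lemma right_smul_complex (c : ℂ) (a : A) (ρ : E) :
    MulOpposite.op a • c • ρ = c • MulOpposite.op a • ρ :=
  (rmul A E a).map_smul c ρ

/-- `a ⊗ ρ ↦ a ρ`. -/
def actL : A ⊗[ℂ] E →ₗ[ℂ] E := TensorProduct.lift (lmul A E)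

/-- `ρ ⊗ a ↦ ρ a`. -/
def actR : E ⊗[ℂ] A →ₗ[ℂ] E := TensorProduct.lift (rmul A E).flip

@[simp] lemma actL_tmul (a : A) (ρ : E) : actL (a ⊗ₜ[ℂ] ρ) = a • ρ := rfl

@[simp] lemma actR_tmul (a : A) (ρ : E) : actR (ρ ⊗ₜ[ℂ] a) = MulOpposite.op a • ρ := rfl

/-! ### Factorwise products on triple tensor products -/

/-- Factorwise left multiplication on `A ⊗ A ⊗ E`. -/
def lmulAAE : A ⊗[ℂ] (A ⊗[ℂ] A) →ₗ[ℂ] A ⊗[ℂ] (A ⊗[ℂ] E) →ₗ[ℂ] A ⊗[ℂ] (A ⊗[ℂ] E) :=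
  TensorProduct.map₂ (LinearMap.mul ℂ A) (lmulAE A E)

/-- Factorwise left multiplication on `E ⊗ A ⊗ A`. -/
def lmulEAA : A ⊗[ℂ] (A ⊗[ℂ] A) →ₗ[ℂ] E ⊗[ℂ] (A ⊗[ℂ] A) →ₗ[ℂ] E ⊗[ℂ] (A ⊗[ℂ] A) :=
  TensorProduct.map₂ (lmul A E) (LinearMap.mul ℂ (A ⊗[ℂ] A))

/-- Factorwise left multiplication on `A ⊗ E ⊗ A`. -/
def lmulAEA : A ⊗[ℂ] (A ⊗[ℂ] A) →ₗ[ℂ] A ⊗[ℂ] (E ⊗[ℂ] A) →ₗ[ℂ] A ⊗[ℂ] (E ⊗[ℂ] A) :=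
  TensorProduct.map₂ (LinearMap.mul ℂ A) (lmulEA A E)

lemma assoc_lmulAE_tmul (u v : A ⊗[ℂ] A) (b : A) (ρ : E) :
    TensorProduct.assoc ℂ A A E ((u * v) ⊗ₜ (b • ρ)) =
      lmulAAE (TensorProduct.assoc ℂ A A A (u ⊗ₜ b)) (TensorProduct.assoc ℂ A A E (v ⊗ₜ ρ)) := by
  induction u with
  | zero => simp
  | add x y hx hy => simp [add_mul, TensorProduct.add_tmul, hx, hy]
  | tmul a a' =>
    induction v with
    | zero => simp
    | add x y hx hy => simp [mul_add, TensorProduct.add_tmul, hx, hy]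
    | tmul c c' => simp [lmulAAE]

lemma assoc_lmulEA_tmul (x : A ⊗[ℂ] A) (z : E ⊗[ℂ] A) (b c : A) :
    TensorProduct.assoc ℂ E A A (lmulEA A E x z ⊗ₜ (b * c)) =
      lmulEAA (TensorProduct.assoc ℂ A A A (x ⊗ₜ b)) (TensorProduct.assoc ℂ E A A (z ⊗ₜ c)) := by
  induction x with
  | zero => simp
  | add x y hx hy => simp [TensorProduct.add_tmul, hx, hy]
  | tmul a a' =>
    induction z with
    | zero => simp
    | add x y hx hy => simp [TensorProduct.add_tmul, hx, hy]
    | tmul c c' => simp [lmulEAA]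

lemma assoc_lmulAEA_tmul (x : A ⊗[ℂ] A) (z : A ⊗[ℂ] E) (b c : A) :
    TensorProduct.assoc ℂ A E A (lmulAE A E x z ⊗ₜ (b * c)) =
      lmulAEA (TensorProduct.assoc ℂ A A A (x ⊗ₜ b)) (TensorProduct.assoc ℂ A E A (z ⊗ₜ c)) := by
  induction x with
  | zero => simp
  | add x y hx hy => simp [TensorProduct.add_tmul, hx, hy]
  | tmul a a' =>
    induction z with
    | zero => simp
    | add x y hx hy => simp [TensorProduct.add_tmul, hx, hy]
    | tmul c c' => simp [lmulAEA]

lemma assoc_comul_lmulAE (x : A ⊗[ℂ] A) (z : A ⊗[ℂ] E) :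
    TensorProduct.assoc ℂ A A E (comul.rTensor E (lmulAE A E x z)) =
      lmulAAE (TensorProduct.assoc ℂ A A A (comul.rTensor A x))
        (TensorProduct.assoc ℂ A A E (comul.rTensor E z)) := by
  induction x with
  | zero => simp
  | add x y hx hy => simp [hx, hy]
  | tmul a b =>
    induction z with
    | zero => simp
    | add x y hx hy => simp [hx, hy]
    | tmul c ρ => simp [assoc_lmulAE_tmul]

lemma comul_lmulEA (x : A ⊗[ℂ] A) (z : E ⊗[ℂ] A) :
    comul.lTensor E (lmulEA A E x z) = lmulEAA (comul.lTensor A x) (comul.lTensor E z) := by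
  induction x with
  | zero => simp
  | add x y hx hy => simp [hx, hy]
  | tmul a b =>
    induction z with
    | zero => simp
    | add x y hx hy => simp [hx, hy]
    | tmul c ρ => simp [lmulEAA]

namespace BicovariantCalculus

variable (D : BicovariantCalculus A E)

/-! ### The coactions are bicomodule structures -/

lemma d_one : D.d 1 = 0 := by
  have := D.leibniz 1 1
  simpa using this

lemma coactL_d (b : A) : D.coactL (D.d b) = D.d.lTensor A (comul b) := by
  have := D.coactL_form 1 b
  rw [one_smul] at this
  rw [this, Bialgebra.comul_one]
  induction (comul (R := ℂ) b : A ⊗[ℂ] A) with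
  | zero => simp
  | add x y hx hy => simp [hx, hy]
  | tmul x y => simp [Algebra.TensorProduct.one_def]

lemma coactR_d (b : A) : D.coactR (D.d b) = D.d.rTensor A (comul b) := by
  have := D.coactR_form 1 b
  rw [one_smul] at this
  rw [this, Bialgebra.comul_one]
  induction (comul (R := ℂ) b : A ⊗[ℂ] A) with
  | zero => simp
  | add x y hx hy => simp [hx, hy]
  | tmul x y => simp [Algebra.TensorProduct.one_def]

/-- Linear maps on `E` agree once they agree on forms `a db`. -/
lemma hom_ext_form {W : Type*} [AddCommGroup W] [Module ℂ W] {f g : E →ₗ[ℂ] W}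
    (h : ∀ a b : A, f (a • D.d b) = g (a • D.d b)) (ρ : E) : f ρ = g ρ := by
  obtain ⟨n, a, b, rfl⟩ := D.exists_sum ρ
  simp [h]

lemma lTensor_coactL_lmulAE (x : A ⊗[ℂ] A) (z : A ⊗[ℂ] E) :
    D.coactL.lTensor A (lmulAE A E x z) =
      lmulAAE (comul.lTensor A x) (D.coactL.lTensor A z) := by
  induction x with
  | zero => simp
  | add x y hx hy => simp [hx, hy]
  | tmul a b =>
    induction z with
    | zero => simp
    | add x y hx hy => simp [hx, hy]
    | tmul c ρ => simp [lmulAAE, coactL_smul]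

lemma lTensor_coactR_lmulAE (x : A ⊗[ℂ] A) (z : A ⊗[ℂ] E) :
    D.coactR.lTensor A (lmulAE A E x z) =
      lmulAEA (comul.lTensor A x) (D.coactR.lTensor A z) := by
  induction x with
  | zero => simp
  | add x y hx hy => simp [hx, hy]
  | tmul a b =>
    induction z with
    | zero => simp
    | add x y hx hy => simp [hx, hy]
    | tmul c ρ => simp [lmulAEA, coactR_smul]

lemma assoc_coactR_lmulEA (x : A ⊗[ℂ] A) (z : E ⊗[ℂ] A) :
    TensorProduct.assoc ℂ E A A (D.coactR.rTensor A (lmulEA A E x z)) =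
      lmulEAA (TensorProduct.assoc ℂ A A A (comul.rTensor A x))
        (TensorProduct.assoc ℂ E A A (D.coactR.rTensor A z)) := by
  induction x with
  | zero => simp
  | add x y hx hy => simp [hx, hy]
  | tmul a b =>
    induction z with
    | zero => simp
    | add x y hx hy => simp [hx, hy]
    | tmul c ρ => simp [coactR_smul, assoc_lmulEA_tmul]

lemma assoc_coactL_lmulEA (x : A ⊗[ℂ] A) (z : E ⊗[ℂ] A) :
    TensorProduct.assoc ℂ A E A (D.coactL.rTensor A (lmulEA A E x z)) =
      lmulAEA (TensorProduct.assoc ℂ A A A (comul.rTensor A x))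
        (TensorProduct.assoc ℂ A E A (D.coactL.rTensor A z)) := by
  induction x with
  | zero => simp
  | add x y hx hy => simp [hx, hy]
  | tmul a b =>
    induction z with
    | zero => simp
    | add x y hx hy => simp [hx, hy]
    | tmul c ρ => simp [coactL_smul, assoc_lmulAEA_tmul]

lemma assoc_tmul_d (u : A ⊗[ℂ] A) (b : A) :
    TensorProduct.assoc ℂ A A E (u ⊗ₜ D.d b) =
      (D.d.lTensor A).lTensor A (TensorProduct.assoc ℂ A A A (u ⊗ₜ b)) := by
  induction u with
  | zero => simp
  | add x y hx hy => simp [TensorProduct.add_tmul, hx, hy]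
  | tmul x y => simp

lemma assoc_d_tmul (u : A ⊗[ℂ] A) (b : A) :
    TensorProduct.assoc ℂ E A A (D.d.rTensor A u ⊗ₜ b) =
      D.d.rTensor (A ⊗[ℂ] A) (TensorProduct.assoc ℂ A A A (u ⊗ₜ b)) := by
  induction u with
  | zero => simp
  | add x y hx hy => simp [TensorProduct.add_tmul, hx, hy]
  | tmul x y => simp

lemma assoc_lTensor_d_tmul (u : A ⊗[ℂ] A) (b : A) :
    TensorProduct.assoc ℂ A E A (D.d.lTensor A u ⊗ₜ b) =
      (D.d.rTensor A).lTensor A (TensorProduct.assoc ℂ A A A (u ⊗ₜ b)) := by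
  induction u with
  | zero => simp
  | add x y hx hy => simp [TensorProduct.add_tmul, hx, hy]
  | tmul x y => simp

/-- On `a db` both sides are the iterated coproduct of `a` acting on their values at `db`. The
values at `db` agree because `d` carries `Δ` to `Δ_E`, so coassociativity of `A` suffices twice. The
two lemmas that follow have the same proof. -/
lemma coactL_coassoc (ρ : E) :
    TensorProduct.assoc ℂ A A E (comul.rTensor E (D.coactL ρ)) =
      D.coactL.lTensor A (D.coactL ρ) := by
  refine D.hom_ext_form
    (f := (TensorProduct.assoc ℂ A A E).toLinearMap ∘ₗ comul.rTensor E ∘ₗ D.coactL)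
    (g := D.coactL.lTensor A ∘ₗ D.coactL) (fun a b => ?_) ρ
  have hd : TensorProduct.assoc ℂ A A E (comul.rTensor E (D.d.lTensor A (comul b))) =
      D.coactL.lTensor A (D.d.lTensor A (comul b)) := by
    have h₁ : ∀ u : A ⊗[ℂ] A, TensorProduct.assoc ℂ A A E (comul.rTensor E (D.d.lTensor A u)) =
        (D.d.lTensor A).lTensor A (TensorProduct.assoc ℂ A A A (comul.rTensor A u)) := fun u => by
      induction u with
      | zero => simp
      | add x y hx hy => simp [hx, hy]
      | tmul x y => simp [assoc_tmul_d]
    have h₂ : ∀ u : A ⊗[ℂ] A, D.coactL.lTensor A (D.d.lTensor A u) =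
        (D.d.lTensor A).lTensor A (comul.lTensor A u) := fun u => by
      induction u with
      | zero => simp
      | add x y hx hy => simp [hx, hy]
      | tmul x y => simp [coactL_d]
    rw [h₁, h₂, coassoc_apply]
  simp only [LinearMap.comp_apply, LinearEquiv.coe_coe, coactL_form, assoc_comul_lmulAE,
    lTensor_coactL_lmulAE, coassoc_apply, hd]

lemma coactR_coassoc (ρ : E) :
    TensorProduct.assoc ℂ E A A (D.coactR.rTensor A (D.coactR ρ)) =
      comul.lTensor E (D.coactR ρ) := by
  refine D.hom_ext_form
    (f := (TensorProduct.assoc ℂ E A A).toLinearMap ∘ₗ D.coactR.rTensor A ∘ₗ D.coactR)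
    (g := comul.lTensor E ∘ₗ D.coactR) (fun a b => ?_) ρ
  have hd : TensorProduct.assoc ℂ E A A (D.coactR.rTensor A (D.d.rTensor A (comul b))) =
      comul.lTensor E (D.d.rTensor A (comul b)) := by
    have h₁ : ∀ u : A ⊗[ℂ] A,
        TensorProduct.assoc ℂ E A A (D.coactR.rTensor A (D.d.rTensor A u)) =
        D.d.rTensor (A ⊗[ℂ] A) (TensorProduct.assoc ℂ A A A (comul.rTensor A u)) := fun u => by
      induction u with
      | zero => simp
      | add x y hx hy => simp [hx, hy]
      | tmul x y => simp [coactR_d, assoc_d_tmul]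
    have h₂ : ∀ u : A ⊗[ℂ] A, comul.lTensor E (D.d.rTensor A u) =
        D.d.rTensor (A ⊗[ℂ] A) (comul.lTensor A u) := fun u => by
      induction u with
      | zero => simp
      | add x y hx hy => simp [hx, hy]
      | tmul x y => simp
    rw [h₁, h₂, coassoc_apply]
  simp only [LinearMap.comp_apply, LinearEquiv.coe_coe, coactR_form, assoc_coactR_lmulEA,
    comul_lmulEA, coassoc_apply, hd]

/-- The two coactions commute. This is what makes each of them preserve the invariants of the other.
-/
lemma coactL_coactR (ρ : E) :
    TensorProduct.assoc ℂ A E A (D.coactL.rTensor A (D.coactR ρ)) =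
      D.coactR.lTensor A (D.coactL ρ) := by
  refine D.hom_ext_form
    (f := (TensorProduct.assoc ℂ A E A).toLinearMap ∘ₗ D.coactL.rTensor A ∘ₗ D.coactR)
    (g := D.coactR.lTensor A ∘ₗ D.coactL) (fun a b => ?_) ρ
  have hd : TensorProduct.assoc ℂ A E A (D.coactL.rTensor A (D.d.rTensor A (comul b))) =
      D.coactR.lTensor A (D.d.lTensor A (comul b)) := by
    have h₁ : ∀ u : A ⊗[ℂ] A,
        TensorProduct.assoc ℂ A E A (D.coactL.rTensor A (D.d.rTensor A u)) =
        (D.d.rTensor A).lTensor A (TensorProduct.assoc ℂ A A A (comul.rTensor A u)) := fun u => by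
      induction u with
      | zero => simp
      | add x y hx hy => simp [hx, hy]
      | tmul x y => simp [coactL_d, assoc_lTensor_d_tmul]
    have h₂ : ∀ u : A ⊗[ℂ] A, D.coactR.lTensor A (D.d.lTensor A u) =
        (D.d.rTensor A).lTensor A (comul.lTensor A u) := fun u => by
      induction u with
      | zero => simp
      | add x y hx hy => simp [hx, hy]
      | tmul x y => simp [coactR_d]
    rw [h₁, h₂, coassoc_apply]
  simp only [LinearMap.comp_apply, LinearEquiv.coe_coe, coactL_form, coactR_form,
    assoc_coactL_lmulEA, lTensor_coactR_lmulAE, coassoc_apply, hd]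

lemma coactL_counit (ρ : E) : TensorProduct.lid ℂ E (counit.rTensor E (D.coactL ρ)) = ρ := by
  refine D.hom_ext_form
    (f := (TensorProduct.lid ℂ E).toLinearMap ∘ₗ counit.rTensor E ∘ₗ D.coactL)
    (g := LinearMap.id) (fun a b => ?_) ρ
  have h : ∀ (x y : A ⊗[ℂ] A),
      TensorProduct.lid ℂ E (counit.rTensor E (lmulAE A E x (D.d.lTensor A y))) =
      TensorProduct.lid ℂ A (counit.rTensor A x) •
        D.d (TensorProduct.lid ℂ A (counit.rTensor A y)) := fun x y => by
    induction x with
    | zero => simp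
    | add x y hx hy => simp [hx, hy, add_smul]
    | tmul a b =>
      induction y with
      | zero => simp
      | add x y hx hy => simp [hx, hy]
      | tmul c c' => simp [mul_smul, left_smul_complex]; exact smul_comm _ _ _
  simp [coactL_form, h]

lemma coactR_counit (ρ : E) : TensorProduct.rid ℂ E (counit.lTensor E (D.coactR ρ)) = ρ := by
  refine D.hom_ext_form
    (f := (TensorProduct.rid ℂ E).toLinearMap ∘ₗ counit.lTensor E ∘ₗ D.coactR)
    (g := LinearMap.id) (fun a b => ?_) ρ
  have h : ∀ (x y : A ⊗[ℂ] A),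
      TensorProduct.rid ℂ E (counit.lTensor E (lmulEA A E x (D.d.rTensor A y))) =
      TensorProduct.rid ℂ A (counit.lTensor A x) •
        D.d (TensorProduct.rid ℂ A (counit.lTensor A y)) := fun x y => by
    induction x with
    | zero => simp
    | add x y hx hy => simp [hx, hy, add_smul]
    | tmul a b =>
      induction y with
      | zero => simp
      | add x y hx hy => simp [hx, hy]
      | tmul c c' => simp [mul_smul, left_smul_complex]; exact smul_comm _ _ _
  simp [coactR_form, h]

/-! ### The projections onto the invariant forms -/

/-- `ρ ↦ S(ρ₍₋₁₎) ρ₍₀₎`. -/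
def projL : E →ₗ[ℂ] E := actL ∘ₗ (antipode ℂ).rTensor E ∘ₗ D.coactL

/-- `ρ ↦ ρ₍₀₎ S(ρ₍₁₎)`. -/
def projR : E →ₗ[ℂ] E := actR ∘ₗ (antipode ℂ).lTensor E ∘ₗ D.coactR

lemma projL_apply (ρ : E) : D.projL ρ = actL ((antipode ℂ).rTensor E (D.coactL ρ)) := rfl

lemma projR_apply (ρ : E) : D.projR ρ = actR ((antipode ℂ).lTensor E (D.coactR ρ)) := rfl

lemma mem_leftInv {ω : E} : ω ∈ D.leftInv ↔ D.coactL ω = 1 ⊗ₜ ω := Iff.rfl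

lemma mem_rightInv {η : E} : η ∈ D.rightInv ↔ D.coactR η = η ⊗ₜ 1 := Iff.rfl

lemma projL_of_mem {ω : E} (h : ω ∈ D.leftInv) : D.projL ω = ω := by
  simp [projL_apply, D.mem_leftInv.1 h]

lemma projR_of_mem {η : E} (h : η ∈ D.rightInv) : D.projR η = η := by
  simp [projR_apply, D.mem_rightInv.1 h]

/-- `S` reverses products, so `S(a₁ ρ₋₁) a₂ ρ₀ = S(ρ₋₁) S(a₁) a₂ ρ₀`, and the middle factor
collapses to `ε(a)`. -/
lemma projL_smul (a : A) (ρ : E) : D.projL (a • ρ) = counit (R := ℂ) a • D.projL ρ := by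
  have h : ∀ (x : A ⊗[ℂ] A) (c : A) (ν : E),
      actL ((antipode ℂ).rTensor E (lmulAE A E x (c ⊗ₜ ν))) =
        antipode ℂ c • (LinearMap.mul' ℂ A ((antipode ℂ).rTensor A x)) • ν := fun x c ν => by
    induction x with
    | zero => simp
    | add x y hx hy => simp [hx, hy, add_smul]
    | tmul a b => simp [antipode_mul_antidistrib, mul_smul]
  rw [projL_apply, projL_apply, coactL_smul]
  induction D.coactL ρ with
  | zero => simp
  | add x y hx hy => simp [hx, hy]
  | tmul c ν => simp [h, left_smul_complex]

lemma projR_op_smul (a : A) (ρ : E) :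
    D.projR (MulOpposite.op a • ρ) = counit (R := ℂ) a • D.projR ρ := by
  have h : ∀ (x : A ⊗[ℂ] A) (c : A) (ν : E),
      actR ((antipode ℂ).lTensor E (rmulEA A E x (ν ⊗ₜ c))) =
        MulOpposite.op (antipode ℂ c) •
          MulOpposite.op (LinearMap.mul' ℂ A ((antipode ℂ).lTensor A x)) • ν := fun x c ν => by
    induction x with
    | zero => simp
    | add x y hx hy => simp [hx, hy, add_smul]
    | tmul a b => simp [antipode_mul_antidistrib, mul_smul]
  rw [projR_apply, projR_apply, coactR_op_smul]
  induction D.coactR ρ with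
  | zero => simp
  | add x y hx hy => simp [hx, hy]
  | tmul ν c => simp [h, op_algebraMap_smul, right_smul_complex]

/-- `ρ ↦ ρ₍₋₁₎ ⊗ P(ρ₍₀₎)`, with `P` the projection onto the left-invariant forms. -/
def trivL : E →ₗ[ℂ] A ⊗[ℂ] E := D.projL.lTensor A ∘ₗ D.coactL

/-- `ρ ↦ P(ρ₍₀₎) ⊗ ρ₍₁₎`, with `P` the projection onto the right-invariant forms. -/
def trivR : E →ₗ[ℂ] E ⊗[ℂ] A := D.projR.rTensor A ∘ₗ D.coactR

lemma trivL_apply (ρ : E) : D.trivL ρ = D.projL.lTensor A (D.coactL ρ) := rfl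

lemma trivR_apply (ρ : E) : D.trivR ρ = D.projR.rTensor A (D.coactR ρ) := rfl

/-- The cancellation `ρ₋₂ S(ρ₋₁) ρ₀ = ρ`; it shows that `E` is generated on the left by the image of
`projL`. -/
lemma actL_trivL (ρ : E) : actL (D.trivL ρ) = ρ := by
  have h₁ : ∀ z : A ⊗[ℂ] E, actL (D.projL.lTensor A z) =
      actL (((actL ∘ₗ (antipode ℂ).rTensor E).lTensor A) (D.coactL.lTensor A z)) := fun z => by
    induction z with
    | zero => simp
    | add x y hx hy => simp [hx, hy]
    | tmul c ν => simp [projL_apply]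
  have h₂ : ∀ (u : A ⊗[ℂ] A) (ν : E), actL (((actL ∘ₗ (antipode ℂ).rTensor E).lTensor A)
      (TensorProduct.assoc ℂ A A E (u ⊗ₜ ν))) =
        (LinearMap.mul' ℂ A ((antipode ℂ).lTensor A u)) • ν := fun u ν => by
    induction u with
    | zero => simp
    | add x y hx hy => simp [hx, hy, add_smul, TensorProduct.add_tmul]
    | tmul a b => simp [mul_smul]
  have h₃ : ∀ z : A ⊗[ℂ] E, actL (((actL ∘ₗ (antipode ℂ).rTensor E).lTensor A)
      (TensorProduct.assoc ℂ A A E (comul.rTensor E z))) =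
        TensorProduct.lid ℂ E (counit.rTensor E z) := fun z => by
    induction z with
    | zero => simp
    | add x y hx hy => simp [hx, hy]
    | tmul c ν => simp [h₂]
  rw [trivL_apply, h₁, ← coactL_coassoc, h₃, coactL_counit]

lemma actR_trivR (ρ : E) : actR (D.trivR ρ) = ρ := by
  have h₁ : ∀ z : E ⊗[ℂ] A, actR (D.projR.rTensor A z) =
      actR (((actR ∘ₗ (antipode ℂ).lTensor E).rTensor A) (D.coactR.rTensor A z)) := fun z => by
    induction z with
    | zero => simp
    | add x y hx hy => simp [hx, hy]
    | tmul c ν => simp [projR_apply]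
  have h₂ : ∀ (u : A ⊗[ℂ] A) (ν : E), actR (((actR ∘ₗ (antipode ℂ).lTensor E).rTensor A)
      ((TensorProduct.assoc ℂ E A A).symm (ν ⊗ₜ u))) =
        MulOpposite.op (LinearMap.mul' ℂ A ((antipode ℂ).rTensor A u)) • ν := fun u ν => by
    induction u with
    | zero => simp
    | add x y hx hy => simp [hx, hy, add_smul, TensorProduct.tmul_add]
    | tmul a b => simp [mul_smul]
  have h₃ : ∀ z : E ⊗[ℂ] A, actR (((actR ∘ₗ (antipode ℂ).lTensor E).rTensor A)
      ((TensorProduct.assoc ℂ E A A).symm (comul.lTensor E z))) =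
        TensorProduct.rid ℂ E (counit.lTensor E z) := fun z => by
    induction z with
    | zero => simp
    | add x y hx hy => simp [hx, hy]
    | tmul c ν => simp [h₂, op_algebraMap_smul]
  rw [trivR_apply, h₁, ← LinearEquiv.symm_apply_apply (TensorProduct.assoc ℂ E A A)
    (D.coactR.rTensor A (D.coactR ρ)), coactR_coassoc, h₃, coactR_counit]

/-- `a ⊗ ω ↦ Δ(a) (1 ⊗ ω)`. -/
def comulActL : A ⊗[ℂ] E →ₗ[ℂ] A ⊗[ℂ] E :=
  TensorProduct.lift ((lmulAE A E).compl₁₂ comul (TensorProduct.mk ℂ A E 1))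

/-- `η ⊗ a ↦ (η ⊗ 1) Δ(a)`. -/
def comulActR : E ⊗[ℂ] A →ₗ[ℂ] E ⊗[ℂ] A :=
  TensorProduct.lift ((rmulEA A E).compl₁₂ comul ((TensorProduct.mk ℂ E A).flip 1)).flip

@[simp] lemma comulActL_tmul (a : A) (ω : E) :
    comulActL (a ⊗ₜ[ℂ] ω) = lmulAE A E (comul a) (1 ⊗ₜ ω) := rfl

@[simp] lemma comulActR_tmul (a : A) (η : E) :
    comulActR (η ⊗ₜ[ℂ] a) = rmulEA A E (comul a) (η ⊗ₜ 1) := rfl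

/-- The same cancellation behind one more tensor factor: `ρ₋₂ ⊗ ρ₋₁ P(ρ₀) = ρ₋₁ ⊗ ρ₀`. It gives the
formula that invariance of `P(ρ₀)` would imply, without presupposing it, and so serves to prove that
invariance. -/
lemma comulActL_trivL (ρ : E) : comulActL (D.trivL ρ) = D.coactL ρ := by
  have h₂ : ∀ (u : A ⊗[ℂ] A) (ν : E), lmulAE A E u (1 ⊗ₜ D.projL ν) =
      (actL ∘ₗ D.projL.lTensor A).lTensor A (TensorProduct.assoc ℂ A A E (u ⊗ₜ ν)) :=
    fun u ν => by
      induction u with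
      | zero => simp
      | add x y hx hy => simp [hx, hy, TensorProduct.add_tmul]
      | tmul a b => simp
  have h₃ : ∀ z : A ⊗[ℂ] E, comulActL (D.projL.lTensor A z) =
      (actL ∘ₗ D.projL.lTensor A).lTensor A
        (TensorProduct.assoc ℂ A A E (comul.rTensor E z)) := fun z => by
    induction z with
    | zero => simp
    | add x y hx hy => simp [hx, hy]
    | tmul c ν => simp [h₂]
  have h₄ : ∀ z : A ⊗[ℂ] E,
      (actL ∘ₗ D.projL.lTensor A).lTensor A (D.coactL.lTensor A z) = z := fun z => by
    induction z with
    | zero => simp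
    | add x y hx hy => simp only [map_add, hx, hy]
    | tmul c ν =>
      simp only [LinearMap.lTensor_tmul, LinearMap.comp_apply]
      rw [← trivL_apply, actL_trivL]
  rw [trivL_apply, h₃, coactL_coassoc, h₄]

lemma comulActR_trivR (ρ : E) : comulActR (D.trivR ρ) = D.coactR ρ := by
  have h₂ : ∀ (u : A ⊗[ℂ] A) (ν : E), rmulEA A E u (D.projR ν ⊗ₜ 1) =
      (actR ∘ₗ D.projR.rTensor A).rTensor A ((TensorProduct.assoc ℂ E A A).symm (ν ⊗ₜ u)) :=
    fun u ν => by
      induction u with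
      | zero => simp
      | add x y hx hy => simp [hx, hy, TensorProduct.tmul_add]
      | tmul a b => simp
  have h₃ : ∀ z : E ⊗[ℂ] A, comulActR (D.projR.rTensor A z) =
      (actR ∘ₗ D.projR.rTensor A).rTensor A
        ((TensorProduct.assoc ℂ E A A).symm (comul.lTensor E z)) := fun z => by
    induction z with
    | zero => simp
    | add x y hx hy => simp [hx, hy]
    | tmul c ν => simp [h₂]
  have h₄ : ∀ z : E ⊗[ℂ] A,
      (actR ∘ₗ D.projR.rTensor A).rTensor A (D.coactR.rTensor A z) = z := fun z => by
    induction z with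
    | zero => simp
    | add x y hx hy => simp only [map_add, hx, hy]
    | tmul c ν =>
      simp only [LinearMap.rTensor_tmul, LinearMap.comp_apply]
      rw [← trivR_apply, actR_trivR]
  rw [trivR_apply, h₃, ← coactR_coassoc, LinearEquiv.symm_apply_apply, h₄]

lemma lmulAE_one (z : A ⊗[ℂ] E) : lmulAE A E 1 z = z := by
  induction z with
  | zero => simp
  | add x y hx hy => simp [hx, hy]
  | tmul c ν => simp [Algebra.TensorProduct.one_def]

lemma rmulEA_one (z : E ⊗[ℂ] A) : rmulEA A E 1 z = z := by
  induction z with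
  | zero => simp
  | add x y hx hy => simp [hx, hy]
  | tmul c ν => simp [Algebra.TensorProduct.one_def]

lemma rmulEA_mul (x y : A ⊗[ℂ] A) (z : E ⊗[ℂ] A) :
    rmulEA A E (x * y) z = rmulEA A E y (rmulEA A E x z) := by
  induction z with
  | zero => simp
  | add u v hu hv => simp [hu, hv]
  | tmul c ρ =>
    induction x with
    | zero => simp
    | add u v hu hv => simp [add_mul, hu, hv]
    | tmul a b =>
      induction y with
      | zero => simp
      | add u v hu hv => simp [mul_add, hu, hv]
      | tmul a' b' => simp [mul_assoc, mul_smul]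

/-- By `comulActL_trivL`, `Δ_E(S(ρ₋₁) ρ₀) = Δ(S(ρ₋₂)) Δ(ρ₋₁) (1 ⊗ P(ρ₀)) = Δ(S(ρ₋₂) ρ₋₁) (1 ⊗ P(ρ₀))
= 1 ⊗ P(ρ)`. Only multiplicativity of `Δ` enters, no formula for `Δ ∘ S`. -/
lemma projL_mem (ρ : E) : D.projL ρ ∈ D.leftInv := by
  let K : A ⊗[ℂ] (A ⊗[ℂ] E) →ₗ[ℂ] A ⊗[ℂ] E :=
    TensorProduct.lift ((lmulAE A E) ∘ₗ comul ∘ₗ antipode ℂ)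
  have hK : ∀ (a : A) (z : A ⊗[ℂ] E), K (a ⊗ₜ z) = lmulAE A E (comul (antipode ℂ a)) z :=
    fun _ _ => rfl
  have h₁ : ∀ z : A ⊗[ℂ] E, D.coactL (actL ((antipode ℂ).rTensor E z)) =
      K (D.coactL.lTensor A z) := fun z => by
    induction z with
    | zero => simp
    | add x y hx hy => simp [hx, hy]
    | tmul c ν => simp [hK, coactL_smul]
  have h₂ : ∀ z : A ⊗[ℂ] E, D.coactL.lTensor A z =
      (comulActL ∘ₗ D.projL.lTensor A).lTensor A (D.coactL.lTensor A z) := fun z => by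
    induction z with
    | zero => simp
    | add x y hx hy => simp only [map_add, ← hx, ← hy]
    | tmul c ν =>
      simp only [LinearMap.lTensor_tmul, LinearMap.comp_apply]
      rw [← trivL_apply, comulActL_trivL]
  have h₃ : ∀ (u : A ⊗[ℂ] A) (ν : E), K ((comulActL ∘ₗ D.projL.lTensor A).lTensor A
      (TensorProduct.assoc ℂ A A E (u ⊗ₜ ν))) =
        lmulAE A E (comul (LinearMap.mul' ℂ A ((antipode ℂ).rTensor A u))) (1 ⊗ₜ D.projL ν) :=
    fun u ν => by
      induction u with
      | zero => simp
      | add x y hx hy => simp [hx, hy, TensorProduct.add_tmul]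
      | tmul a b => simp [hK, lmulAE_mul]
  have h₄ : ∀ z : A ⊗[ℂ] E, K ((comulActL ∘ₗ D.projL.lTensor A).lTensor A
      (TensorProduct.assoc ℂ A A E (comul.rTensor E z))) =
        1 ⊗ₜ D.projL (TensorProduct.lid ℂ E (counit.rTensor E z)) := fun z => by
    induction z with
    | zero => simp
    | add x y hx hy => simp [hx, hy, TensorProduct.tmul_add]
    | tmul c ν => simp [h₃, Algebra.algebraMap_eq_smul_one, lmulAE_one]
  rw [mem_leftInv]
  conv_lhs => rw [projL_apply, h₁, h₂, ← coactL_coassoc, h₄, coactL_counit]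

lemma projR_mem (ρ : E) : D.projR ρ ∈ D.rightInv := by
  let K : (E ⊗[ℂ] A) ⊗[ℂ] A →ₗ[ℂ] E ⊗[ℂ] A :=
    TensorProduct.lift ((rmulEA A E) ∘ₗ comul ∘ₗ antipode ℂ).flip
  have hK : ∀ (a : A) (z : E ⊗[ℂ] A), K (z ⊗ₜ a) = rmulEA A E (comul (antipode ℂ a)) z :=
    fun _ _ => rfl
  have h₁ : ∀ z : E ⊗[ℂ] A, D.coactR (actR ((antipode ℂ).lTensor E z)) =
      K (D.coactR.rTensor A z) := fun z => by
    induction z with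
    | zero => simp
    | add x y hx hy => simp [hx, hy]
    | tmul c ν => simp [hK, coactR_op_smul]
  have h₂ : ∀ z : E ⊗[ℂ] A, D.coactR.rTensor A z =
      (comulActR ∘ₗ D.projR.rTensor A).rTensor A (D.coactR.rTensor A z) := fun z => by
    induction z with
    | zero => simp
    | add x y hx hy => simp only [map_add, ← hx, ← hy]
    | tmul c ν =>
      simp only [LinearMap.rTensor_tmul, LinearMap.comp_apply]
      rw [← trivR_apply, comulActR_trivR]
  have h₃ : ∀ (u : A ⊗[ℂ] A) (ν : E), K ((comulActR ∘ₗ D.projR.rTensor A).rTensor A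
      ((TensorProduct.assoc ℂ E A A).symm (ν ⊗ₜ u))) =
        rmulEA A E (comul (LinearMap.mul' ℂ A ((antipode ℂ).lTensor A u))) (D.projR ν ⊗ₜ 1) :=
    fun u ν => by
      induction u with
      | zero => simp
      | add x y hx hy => simp [hx, hy, TensorProduct.tmul_add]
      | tmul a b => simp [hK, rmulEA_mul]
  have h₄ : ∀ z : E ⊗[ℂ] A, K ((comulActR ∘ₗ D.projR.rTensor A).rTensor A
      ((TensorProduct.assoc ℂ E A A).symm (comul.lTensor E z))) =
        D.projR (TensorProduct.rid ℂ E (counit.lTensor E z)) ⊗ₜ 1 := fun z => by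
    induction z with
    | zero => simp
    | add x y hx hy => simp [hx, hy, TensorProduct.add_tmul]
    | tmul c ν => simp [h₃, Algebra.algebraMap_eq_smul_one, rmulEA_one, TensorProduct.smul_tmul']
  rw [mem_rightInv]
  conv_lhs => rw [projR_apply, h₁, h₂, ← LinearEquiv.symm_apply_apply (TensorProduct.assoc ℂ E A A)
    (D.coactR.rTensor A (D.coactR ρ)), coactR_coassoc, h₄, coactR_counit]

lemma trivL_smul (a : A) (ρ : E) :
    D.trivL (a • ρ) = (LinearMap.mul ℂ A a).rTensor E (D.trivL ρ) := by
  have h : ∀ (x : A ⊗[ℂ] A) (z : A ⊗[ℂ] E), D.projL.lTensor A (lmulAE A E x z) =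
      (LinearMap.mul ℂ A (TensorProduct.rid ℂ A (counit.lTensor A x))).rTensor E
        (D.projL.lTensor A z) := fun x z => by
    induction x with
    | zero => simp
    | add x y hx hy => simp [hx, hy, LinearMap.rTensor_add]
    | tmul a b =>
      induction z with
      | zero => simp
      | add x y hx hy => simp [hx, hy]
      | tmul c ν => simp [projL_smul, TensorProduct.smul_tmul']
  rw [trivL_apply, coactL_smul, h]
  simp [trivL_apply]

lemma trivR_op_smul (a : A) (ρ : E) :
    D.trivR (MulOpposite.op a • ρ) = ((LinearMap.mul ℂ A).flip a).lTensor E (D.trivR ρ) := by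
  have h : ∀ (x : A ⊗[ℂ] A) (z : E ⊗[ℂ] A), D.projR.rTensor A (rmulEA A E x z) =
      ((LinearMap.mul ℂ A).flip (TensorProduct.lid ℂ A (counit.rTensor A x))).lTensor E
        (D.projR.rTensor A z) := fun x z => by
    induction x with
    | zero => simp
    | add x y hx hy => simp [hx, hy, LinearMap.lTensor_add]
    | tmul a b =>
      induction z with
      | zero => simp
      | add x y hx hy => simp [hx, hy]
      | tmul c ν => simp [projR_op_smul, TensorProduct.smul_tmul']
  rw [trivR_apply, coactR_op_smul, h]
  simp [trivR_apply]

lemma trivL_of_mem {ω : E} (h : ω ∈ D.leftInv) : D.trivL ω = 1 ⊗ₜ ω := by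
  rw [trivL_apply, D.mem_leftInv.1 h, LinearMap.lTensor_tmul, projL_of_mem D h]

lemma trivR_of_mem {η : E} (h : η ∈ D.rightInv) : D.trivR η = η ⊗ₜ 1 := by
  rw [trivR_apply, D.mem_rightInv.1 h, LinearMap.rTensor_tmul, projR_of_mem D h]

/-- `E` is spanned by the forms `a ω` with `ω` left-invariant. -/
lemma induction_leftInv {p : E → Prop} (ρ : E) (zero : p 0)
    (add : ∀ ρ ν, p ρ → p ν → p (ρ + ν)) (smul : ∀ (a : A), ∀ ω ∈ D.leftInv, p (a • ω)) :
    p ρ := by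
  rw [← D.actL_trivL ρ, trivL_apply]
  induction D.coactL ρ with
  | zero => simpa using zero
  | add x y hx hy => simpa using add _ _ hx hy
  | tmul c ν => simpa using smul c _ (D.projL_mem ν)

/-- `E` is spanned by the forms `η a` with `η` right-invariant. -/
lemma induction_rightInv {p : E → Prop} (ρ : E) (zero : p 0)
    (add : ∀ ρ ν, p ρ → p ν → p (ρ + ν))
    (smul : ∀ (a : A), ∀ η ∈ D.rightInv, p (MulOpposite.op a • η)) : p ρ := by
  rw [← D.actR_trivR ρ, trivR_apply]
  induction D.coactR ρ with
  | zero => simpa using zero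
  | add x y hx hy => simpa using add _ _ hx hy
  | tmul ν c => simpa using smul c _ (D.projR_mem ν)

/-- The right coaction maps left-invariant forms to `₀E ⊗ A`. -/
lemma projL_rTensor_coactR {ω : E} (h : ω ∈ D.leftInv) :
    D.projL.rTensor A (D.coactR ω) = D.coactR ω := by
  have h₁ : ∀ (w : A ⊗[ℂ] E) (a : A), (actL ((antipode ℂ).rTensor E w)) ⊗ₜ[ℂ] a =
      TensorProduct.lift ((TensorProduct.mapBilinear (.id ℂ) E A E A).flip .id ∘ₗ lmul A E ∘ₗ
        antipode ℂ) (TensorProduct.assoc ℂ A E A (w ⊗ₜ a)) := fun w a => by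
    induction w with
    | zero => simp
    | add x y hx hy => simp [hx, hy, TensorProduct.add_tmul]
    | tmul c ν => simp
  have h₂ : ∀ z : E ⊗[ℂ] A, D.projL.rTensor A z =
      TensorProduct.lift ((TensorProduct.mapBilinear (.id ℂ) E A E A).flip .id ∘ₗ lmul A E ∘ₗ
        antipode ℂ) (TensorProduct.assoc ℂ A E A (D.coactL.rTensor A z)) := fun z => by
    induction z with
    | zero => simp
    | add x y hx hy => simp only [map_add, hx, hy]
    | tmul c ν => simp [projL_apply, ← h₁]
  have h₃ : lmul A E 1 = LinearMap.id := by ext; simp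
  -- Projecting the first leg of `coactR ω` multiplies it by `S` of its left coaction leg. Since the
  -- coactions commute, that leg is the one of `ω` itself, which is `1`.
  rw [h₂, coactL_coactR, D.mem_leftInv.1 h]
  simp [h₃]

/-- The left coaction maps right-invariant forms to `A ⊗ E₀`. -/
lemma projR_lTensor_coactL {η : E} (h : η ∈ D.rightInv) :
    D.projR.lTensor A (D.coactL η) = D.coactL η := by
  have h₁ : ∀ (w : E ⊗[ℂ] A) (a : A), a ⊗ₜ[ℂ] (actR ((antipode ℂ).lTensor E w)) =
      TensorProduct.lift ((TensorProduct.mapBilinear (.id ℂ) A E A E .id) ∘ₗ rmul A E ∘ₗ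
        antipode ℂ).flip ((TensorProduct.assoc ℂ A E A).symm (a ⊗ₜ w)) := fun w a => by
    induction w with
    | zero => simp
    | add x y hx hy => simp [hx, hy, TensorProduct.tmul_add]
    | tmul c ν => simp
  have h₂ : ∀ z : A ⊗[ℂ] E, D.projR.lTensor A z =
      TensorProduct.lift ((TensorProduct.mapBilinear (.id ℂ) A E A E .id) ∘ₗ rmul A E ∘ₗ
        antipode ℂ).flip ((TensorProduct.assoc ℂ A E A).symm (D.coactR.lTensor A z)) :=
    fun z => by
      induction z with
      | zero => simp
      | add x y hx hy => simp only [map_add, hx, hy]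
      | tmul c ν => simp [projR_apply, ← h₁]
  have h₃ : rmul A E 1 = LinearMap.id := by ext; simp
  rw [h₂, ← coactL_coactR, D.mem_rightInv.1 h, LinearEquiv.symm_apply_apply]
  simp [h₃]

end BicovariantCalculus

/-! ### Calculation in `E ⊗_A E` and the ingredients of the braiding. -/

@[simp] lemma lmulT_tmulA (a : A) (ρ ν : E) :
    lmulT A E a (tmulA A E ρ ν) = tmulA A E (a • ρ) ν := rfl

@[simp] lemma rmulT_tmulA (a : A) (ρ ν : E) :
    rmulT A E a (tmulA A E ρ ν) = tmulA A E ρ (MulOpposite.op a • ν) := rfl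

lemma tensorSq_induction {p : TensorSq A E → Prop} (t : TensorSq A E) (zero : p 0)
    (add : ∀ x y, p x → p y → p (x + y)) (tmul : ∀ ρ ν, p (tmulA A E ρ ν)) : p t := by
  obtain ⟨z, rfl⟩ := Submodule.mkQ_surjective _ t
  induction z with
  | zero => simpa using zero
  | add x y hx hy => simpa using add _ _ hx hy
  | tmul ρ ν => exact tmul ρ ν

lemma tensorSq_hom_ext {W : Type*} [AddCommGroup W] [Module ℂ W] {f g : TensorSq A E →ₗ[ℂ] W}
    (h : ∀ ρ ν, f (tmulA A E ρ ν) = g (tmulA A E ρ ν)) : f = g := by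
  ext t
  exact h _ _

lemma lmulT_add (a b : A) (x : TensorSq A E) :
    lmulT A E (a + b) x = lmulT A E a x + lmulT A E b x := by
  induction x using tensorSq_induction with
  | zero => simp
  | add x y hx hy => simp only [map_add, hx, hy]; abel
  | tmul ρ ν => simp [add_smul]

lemma lmulT_smul (c : ℂ) (a : A) (x : TensorSq A E) :
    lmulT A E (c • a) x = c • lmulT A E a x := by
  induction x using tensorSq_induction with
  | zero => simp
  | add x y hx hy => simp [map_add, hx, hy]
  | tmul ρ ν => simp

/-- `(x ⊗ ω, η ⊗ y) ↦ x η ⊗_A ω y`. -/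
def crossMap : A ⊗[ℂ] E →ₗ[ℂ] E ⊗[ℂ] A →ₗ[ℂ] TensorSq A E :=
  (TensorProduct.map₂ (lmul A E) (rmul A E).flip).compr₂ (balancing A E).mkQ

@[simp] lemma crossMap_tmul (x y : A) (ω η : E) :
    crossMap (x ⊗ₜ[ℂ] ω) (η ⊗ₜ[ℂ] y) = tmulA A E (x • η) (MulOpposite.op y • ω) := rfl

lemma crossMap_mul_left (a : A) (z : A ⊗[ℂ] E) (w : E ⊗[ℂ] A) :
    crossMap ((LinearMap.mul ℂ A a).rTensor E z) w = lmulT A E a (crossMap z w) := by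
  induction z with
  | zero => simp
  | add x y hx hy => simp [hx, hy]
  | tmul x ω =>
    induction w with
    | zero => simp
    | add x y hx hy => simp only [map_add, hx, hy]
    | tmul η y => simp [mul_smul]

lemma crossMap_mul_right (a : A) (z : A ⊗[ℂ] E) (w : E ⊗[ℂ] A) :
    crossMap z (((LinearMap.mul ℂ A).flip a).lTensor E w) = rmulT A E a (crossMap z w) := by
  induction z with
  | zero => simp
  | add x y hx hy => simp [hx, hy]
  | tmul x ω =>
    induction w with
    | zero => simp
    | add x y hx hy => simp [hx, hy]
    | tmul η y => simp [mul_smul]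

/-- `x ⊗ y ↦ S(x) ω y`. -/
def conjMap (ω : E) : A ⊗[ℂ] A →ₗ[ℂ] E :=
  actL ∘ₗ TensorProduct.map (antipode ℂ) ((rmul A E).flip ω)

@[simp] lemma conjMap_tmul (ω : E) (x y : A) :
    conjMap ω (x ⊗ₜ[ℂ] y) = antipode ℂ x • MulOpposite.op y • ω := rfl

namespace BicovariantCalculus

variable (D : BicovariantCalculus A E)

/-! ### The canonical braiding -/

/-- This is the right adjoint action `ω ↦ S(a₁) ω a₂` of `A` on `₀E`. -/
lemma projL_op_smul_of_mem {ω : E} (h : ω ∈ D.leftInv) (a : A) :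
    D.projL (MulOpposite.op a • ω) = conjMap ω (comul a) := by
  rw [projL_apply, coactL_op_smul, D.mem_leftInv.1 h]
  induction (comul (R := ℂ) a : A ⊗[ℂ] A) with
  | zero => simp
  | add x y hx hy => simp [hx, hy]
  | tmul x y => simp

lemma projL_op_smul_projL (ρ : E) (b : A) :
    D.projL (MulOpposite.op b • D.projL ρ) = D.projL (MulOpposite.op b • ρ) := by
  induction ρ using D.induction_leftInv with
  | zero => simp
  | add ρ ν hρ hν => simp [hρ, hν]
  | smul a ω hω =>
    rw [projL_smul, D.projL_of_mem hω, ← smul_comm a, projL_smul, right_smul_complex, map_smul]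

/-- `ν ⊗ y ↦ ν ⊗ P(ω y)`, with `P` the projection onto the left-invariant forms. -/
def braidInv (ω : E) : E ⊗[ℂ] A →ₗ[ℂ] TensorSq A E :=
  TensorProduct.lift ((tmulA A E).compl₂ (D.projL ∘ₗ (rmul A E).flip ω))

@[simp] lemma braidInv_tmul (ω ν : E) (y : A) :
    D.braidInv ω (ν ⊗ₜ y) = tmulA A E ν (D.projL (MulOpposite.op y • ω)) := rfl

/-- Moving `S(ρ₁)` across the balanced tensor product, `ρ₀ S(ρ₁) ⊗ ω ρ₂ = ρ₀ ⊗ S(ρ₁) ω ρ₂ = ρ₀ ⊗ P(ω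
ρ₁)`. This yields the braiding formula `σ(ω ⊗ ρ) = ρ₀ ⊗ P(ω ρ₁)` for left-invariant `ω` and
arbitrary `ρ`. -/
lemma crossMap_trivR {ω : E} (h : ω ∈ D.leftInv) (ρ : E) :
    crossMap (1 ⊗ₜ ω) (D.trivR ρ) = D.braidInv ω (D.coactR ρ) := by
  let F : E ⊗[ℂ] (A ⊗[ℂ] A) →ₗ[ℂ] TensorSq A E :=
    TensorProduct.lift ((tmulA A E).compl₂ (conjMap ω))
  have hF : ∀ ν u, F (ν ⊗ₜ u) = tmulA A E ν (conjMap ω u) := fun _ _ => rfl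
  have h₁ : ∀ (w : E ⊗[ℂ] A) (y : A),
      tmulA A E (actR ((antipode ℂ).lTensor E w)) (MulOpposite.op y • ω) =
      F (TensorProduct.assoc ℂ E A A (w ⊗ₜ y)) := fun w y => by
    induction w with
    | zero => simp
    | add x y hx hy => simp [hx, hy, TensorProduct.add_tmul]
    | tmul ν x => simp [hF, tmulA_balanced]
  have h₂ : ∀ z : E ⊗[ℂ] A, crossMap (1 ⊗ₜ ω) (D.projR.rTensor A z) =
      F (TensorProduct.assoc ℂ E A A (D.coactR.rTensor A z)) := fun z => by
    induction z with
    | zero => simp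
    | add x y hx hy => simp only [map_add, hx, hy]
    | tmul ν y => simp [← h₁, projR_apply]
  have h₃ : ∀ z : E ⊗[ℂ] A, D.braidInv ω z = F (comul.lTensor E z) := fun z => by
    induction z with
    | zero => simp
    | add x y hx hy => simp only [map_add, hx, hy]
    | tmul ν y => simp [hF, D.projL_op_smul_of_mem h]
  rw [trivR_apply, h₂, h₃, coactR_coassoc]

/-- Both sides equal `a₁ η ⊗ P(ω a₂)`. This is the generator case of the balancedness needed to
define `braid`; the general case follows by linearity over `A` on the outer sides. -/
lemma crossMap_trivL_op_smul {ω η : E} (hω : ω ∈ D.leftInv) (hη : η ∈ D.rightInv) (a : A) :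
    crossMap (D.trivL (MulOpposite.op a • ω)) (D.trivR η) =
      crossMap (D.trivL ω) (D.trivR (a • η)) := by
  rw [D.trivL_of_mem hω, D.crossMap_trivR hω, trivL_apply, coactL_op_smul, coactR_smul,
    D.mem_leftInv.1 hω, D.mem_rightInv.1 hη, D.trivR_of_mem hη]
  induction (comul (R := ℂ) a : A ⊗[ℂ] A) with
  | zero => simp
  | add x y hx hy => simp [hx, hy]
  | tmul x y => simp

/-- The braiding `ρ ⊗ ν ↦ ρ₍₋₂₎ ν₍₀₎ S(ρ₍₋₁₎ ν₍₁₎) ⊗ ρ₍₀₎ ν₍₂₎`. -/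
def braid : TensorSq A E →ₗ[ℂ] TensorSq A E :=
  liftA (crossMap.compl₁₂ D.trivL D.trivR) fun a ρ ν => by
    simp only [LinearMap.compl₁₂_apply]
    induction ρ using D.induction_leftInv with
    | zero => simp
    | add x y hx hy => simp [hx, hy]
    | smul b ω hω =>
      rw [← smul_comm b, trivL_smul, trivL_smul, crossMap_mul_left, crossMap_mul_left]
      congr 1
      induction ν using D.induction_rightInv with
      | zero => simp
      | add x y hx hy => simp [hx, hy]
      | smul c η hη =>
        rw [smul_comm a, trivR_op_smul, trivR_op_smul, crossMap_mul_right, crossMap_mul_right,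
          D.crossMap_trivL_op_smul hω hη]

lemma braid_tmulA (ρ ν : E) :
    D.braid (tmulA A E ρ ν) = crossMap (D.trivL ρ) (D.trivR ν) := rfl

lemma isBraiding_braid : D.IsBraiding D.braid where
  map_lmul a x := by
    induction x using tensorSq_induction with
    | zero => simp
    | add x y hx hy => simp [map_add, hx, hy]
    | tmul ρ ν => rw [lmulT_tmulA, braid_tmulA, braid_tmulA, trivL_smul, crossMap_mul_left]
  map_rmul a x := by
    induction x using tensorSq_induction with
    | zero => simp
    | add x y hx hy => simp [map_add, hx, hy]
    | tmul ρ ν => rw [rmulT_tmulA, braid_tmulA, braid_tmulA, trivR_op_smul, crossMap_mul_right]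
  swap ω hω η hη := by
    simp [braid_tmulA, D.trivL_of_mem hω, D.trivR_of_mem hη]

/-- A chosen braiding has the defining properties as soon as some braiding exists, and `braid` is
one. -/
lemma isBraiding_braiding : D.IsBraiding D.braiding :=
  Classical.epsilon_spec ⟨_, D.isBraiding_braid⟩

/-- The tensors `a ω ⊗ η b` with `ω` left-invariant and `η` right-invariant span `E ⊗_A E`, so
bilinearity and the swap rule leave no freedom. -/
lemma braiding_eq : D.braiding = D.braid := by
  refine tensorSq_hom_ext fun ρ ν => ?_
  induction ρ using D.induction_leftInv with
  | zero => simp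
  | add x y hx hy => simp [hx, hy]
  | smul a ω hω =>
    rw [← lmulT_tmulA, D.isBraiding_braiding.map_lmul, D.isBraiding_braid.map_lmul]
    congr 1
    induction ν using D.induction_rightInv with
    | zero => simp
    | add x y hx hy => simp [hx, hy]
    | smul b η hη =>
      rw [← rmulT_tmulA, D.isBraiding_braiding.map_rmul, D.isBraiding_braid.map_rmul,
        D.isBraiding_braiding.swap ω hω η hη, D.isBraiding_braid.swap ω hω η hη]

lemma braiding_tmulA_of_mem {ω : E} (h : ω ∈ D.leftInv) (ρ : E) :
    D.braiding (tmulA A E ω ρ) = D.braidInv ω (D.coactR ρ) := by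
  rw [braiding_eq, braid_tmulA, D.trivL_of_mem h, D.crossMap_trivR h]

lemma wedge_eq_iff (x y : TensorSq A E) :
    D.wedge x = D.wedge y ↔ D.braiding (x - y) = x - y := by
  rw [wedge, Submodule.mkQ_apply, Submodule.mkQ_apply, Submodule.Quotient.eq, LinearMap.mem_ker,
    LinearMap.sub_apply, LinearMap.id_apply, sub_eq_zero]

lemma wedge_eq_zero_iff (x : TensorSq A E) : D.wedge x = 0 ↔ D.braiding x = x := by
  simpa using D.wedge_eq_iff x 0

lemma wedge_lmulT (a : A) {x y : TensorSq A E} (h : D.wedge x = D.wedge y) :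
    D.wedge (lmulT A E a x) = D.wedge (lmulT A E a y) := by
  rw [wedge_eq_iff] at h ⊢
  rw [← map_sub, D.isBraiding_braiding.map_lmul, h]

lemma wedge_rmulT (a : A) {x y : TensorSq A E} (h : D.wedge x = D.wedge y) :
    D.wedge (rmulT A E a x) = D.wedge (rmulT A E a y) := by
  rw [wedge_eq_iff] at h ⊢
  rw [← map_sub, D.isBraiding_braiding.map_rmul, h]

/-! ### The exterior derivative of one-forms -/

/-- The Maurer–Cartan map `b ↦ S(b₍₁₎) db₍₂₎`. -/
def maurerCartan : A →ₗ[ℂ] E := D.projL ∘ₗ D.d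

lemma maurerCartan_apply (b : A) : D.maurerCartan b = D.projL (D.d b) := rfl

lemma maurerCartan_mem (b : A) : D.maurerCartan b ∈ D.leftInv := D.projL_mem _

/-- `projL` is insensitive to first projecting `da`, so the Leibniz rule for `d(ab)` can be
projected directly. -/
lemma projL_maurerCartan_mul (a b : A) :
    D.projL (MulOpposite.op b • D.maurerCartan a) =
      D.maurerCartan (a * b) - counit (R := ℂ) a • D.maurerCartan b := by
  rw [maurerCartan_apply, projL_op_smul_projL, maurerCartan_apply, D.leibniz, map_add, projL_smul]
  simp [maurerCartan_apply]

lemma trivL_d (b : A) : D.trivL (D.d b) = D.maurerCartan.lTensor A (comul b) := by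
  rw [trivL_apply, coactL_d, maurerCartan, LinearMap.lTensor_comp, LinearMap.comp_apply]

lemma actL_maurerCartan (b : A) : actL (D.maurerCartan.lTensor A (comul b)) = D.d b := by
  rw [← trivL_d, actL_trivL]

/-- `ρ ⊗ x ↦ ρ ⊗ ω(x)` with `ω` the Maurer–Cartan map. -/
def tmulMC : E ⊗[ℂ] A →ₗ[ℂ] TensorSq A E :=
  TensorProduct.lift ((tmulA A E).compl₂ D.maurerCartan)

@[simp] lemma tmulMC_tmul (ρ : E) (x : A) :
    D.tmulMC (ρ ⊗ₜ x) = tmulA A E ρ (D.maurerCartan x) := rfl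

/-- `x ⊗ ω ↦ dx ⊗ ω`. -/
def dTmul : A ⊗[ℂ] E →ₗ[ℂ] TensorSq A E := TensorProduct.lift (tmulA A E ∘ₗ D.d)

@[simp] lemma dTmul_tmul (x : A) (ω : E) : D.dTmul (x ⊗ₜ ω) = tmulA A E (D.d x) ω := rfl

/-- Write `a db = a b₁ ω(b₂)`, with `ω` the Maurer–Cartan map, and apply Leibniz to `d(a b₁)`. The
second summand is the one that reappears in `braiding_tmulA_d`. -/
lemma dTmul_trivL (a b : A) : D.dTmul (D.trivL (a • D.d b)) =
    tmulA A E (D.d a) (D.d b) + lmulT A E a (D.tmulMC (D.d.rTensor A (comul b))) := by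
  have h : ∀ v : A ⊗[ℂ] A,
      D.dTmul ((LinearMap.mul ℂ A a).rTensor E (D.maurerCartan.lTensor A v)) =
      tmulA A E (D.d a) (actL (D.maurerCartan.lTensor A v)) +
        lmulT A E a (D.tmulMC (D.d.rTensor A v)) := fun v => by
    induction v with
    | zero => simp
    | add x y hx hy => simp only [map_add, hx, hy]; abel
    | tmul y y' => simp [D.leibniz, tmulA_balanced]
  rw [trivL_smul, trivL_d, h, actL_maurerCartan]

/-- With `da = a₁ ω(a₂)`, the braiding formula gives `a₁ db₁ ⊗ P(ω(a₂) b₂)`, and `P(ω(a₂) b₂) = ω(a₂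
b₂) - ε(a₂) ω(b₂)`. -/
lemma braiding_tmulA_d (a b : A) : D.braiding (tmulA A E (D.d a) (D.d b)) =
    D.tmulMC (D.coactR (a • D.d b)) -
      lmulT A E a (D.tmulMC (D.d.rTensor A (comul b))) := by
  have h₁ : ∀ (x x' : A) (v : A ⊗[ℂ] A),
      lmulT A E x (D.braidInv (D.maurerCartan x') (D.d.rTensor A v)) =
      D.tmulMC (lmulEA A E (x ⊗ₜ x') (D.d.rTensor A v)) -
        counit (R := ℂ) x' • lmulT A E x (D.tmulMC (D.d.rTensor A v)) := fun x x' v => by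
    induction v with
    | zero => simp
    | add x y hx hy => simp only [map_add, hx, hy, smul_add]; abel
    | tmul y y' => simp [projL_maurerCartan_mul]
  have h₂ : ∀ u : A ⊗[ℂ] A,
      D.braiding (tmulA A E (actL (D.maurerCartan.lTensor A u)) (D.d b)) =
      D.tmulMC (lmulEA A E u (D.d.rTensor A (comul b))) -
        lmulT A E (TensorProduct.rid ℂ A (counit.lTensor A u))
          (D.tmulMC (D.d.rTensor A (comul b))) := fun u => by
    induction u with
    -- `lmulT` is not bundled as linear in the algebra element, so multiplication by `0` is treated
    -- as scaling by `0`.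
    | zero => simpa using lmulT_smul (E := E) 0 (0 : A) _
    | add x y hx hy => simp only [map_add, hx, hy, LinearMap.add_apply, lmulT_add]; abel
    | tmul x x' =>
      simp only [LinearMap.lTensor_tmul, actL_tmul, TensorProduct.rid_tmul, lmulT_smul]
      rw [← lmulT_tmulA, D.isBraiding_braiding.map_lmul,
        D.braiding_tmulA_of_mem (D.maurerCartan_mem x'), coactR_d, h₁]
  have := h₂ (comul a)
  rw [actL_maurerCartan] at this
  rw [this, coactR_form]
  simp

/-- `a ⊗ b ↦ da ⊗_A db`. -/
def dTmulD : A ⊗[ℂ] A →ₗ[ℂ] TensorSq A E :=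
  TensorProduct.lift ((tmulA A E).compl₁₂ D.d D.d)

@[simp] lemma dTmulD_tmul (a b : A) : D.dTmulD (a ⊗ₜ b) = tmulA A E (D.d a) (D.d b) := rfl

/-- The terms `a db₁ ⊗ ω(b₂)` of the two preceding formulas cancel, so `(σ - 1)(da ⊗ db)` is a
function of the form `a db` alone. Hence `∑ a db = 0` forces `∑ da ⊗ db ∈ Ker(σ - 1)`, which is what
makes `extDeriv` well defined. -/
lemma braiding_dTmulD (x : A ⊗[ℂ] A) : D.braiding (D.dTmulD x) - D.dTmulD x =
    D.tmulMC (D.coactR (D.formMap x)) - D.dTmul (D.trivL (D.formMap x)) := by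
  induction x with
  | zero => simp
  | add x y hx hy =>
    simp only [map_add, add_sub_add_comm, hx, hy]
  | tmul a b =>
    rw [dTmulD_tmul, formMap_tmul, braiding_tmulA_d, dTmul_trivL]
    abel

lemma ker_formMap_le_wedge :
    LinearMap.ker D.formMap ≤ LinearMap.ker (D.wedge ∘ₗ D.dTmulD) := fun x hx => by
  have := D.braiding_dTmulD x
  rw [LinearMap.mem_ker.1 hx] at this
  rw [LinearMap.mem_ker, LinearMap.comp_apply, wedge_eq_zero_iff]
  simpa [sub_eq_zero] using this

/-- The map `E → Ω²` given by `a db ↦ da ∧ db`. -/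
def extDeriv : E →ₗ[ℂ] D.TwoForms :=
  (LinearMap.ker D.formMap).liftQ (D.wedge ∘ₗ D.dTmulD) D.ker_formMap_le_wedge ∘ₗ
    (D.formMap.quotKerEquivOfSurjective D.formMap_surjective).symm.toLinearMap

lemma extDeriv_form (a b : A) :
    D.extDeriv (a • D.d b) = D.wedge (tmulA A E (D.d a) (D.d b)) := by
  have : (D.formMap.quotKerEquivOfSurjective D.formMap_surjective).symm (D.formMap (a ⊗ₜ b)) =
      (LinearMap.ker D.formMap).mkQ (a ⊗ₜ b) := by
    rw [LinearEquiv.symm_apply_eq]; rfl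
  rw [formMap_tmul] at this
  simp [extDeriv, this]

lemma exists_wedge_extDeriv (ρ : E) : ∃ (n : ℕ) (a b : Fin n → A),
    ρ = ∑ k, a k • D.d (b k) ∧
      D.extDeriv ρ = D.wedge (∑ k, tmulA A E (D.d (a k)) (D.d (b k))) := by
  obtain ⟨n, a, b, rfl⟩ := D.exists_sum ρ
  exact ⟨n, a, b, rfl, by simp [extDeriv_form]⟩

lemma isExteriorDerivative_extDeriv : D.IsExteriorDerivative D.extDeriv where
  d_d a := by
    have := D.extDeriv_form 1 a
    simpa [d_one] using this
  left_leibniz a ρ x hx := by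
    obtain ⟨n, b, c, rfl, h⟩ := D.exists_wedge_extDeriv ρ
    rw [D.wedge_lmulT a (hx.trans h)]
    simp only [Finset.smul_sum, map_sum, ← Finset.sum_add_distrib]
    refine Finset.sum_congr rfl fun k _ => ?_
    rw [smul_smul, extDeriv_form, D.leibniz, map_add, LinearMap.add_apply, map_add,
      tmulA_balanced, lmulT_tmulA]
  right_leibniz a ρ x hx := by
    obtain ⟨n, b, c, rfl, h⟩ := D.exists_wedge_extDeriv ρ
    rw [D.wedge_rmulT a (hx.trans h)]
    simp only [Finset.smul_sum, map_sum, LinearMap.sum_apply, ← Finset.sum_sub_distrib]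
    refine Finset.sum_congr rfl fun k _ => ?_
    rw [form_mul, map_sub, extDeriv_form, extDeriv_form, D.leibniz, D.leibniz]
    simp only [map_add, LinearMap.add_apply, tmulA_balanced, rmulT_tmulA]
    abel

lemma isExteriorDerivative_dOne : D.IsExteriorDerivative D.dOne :=
  Classical.epsilon_spec ⟨_, D.isExteriorDerivative_extDeriv⟩

lemma dOne_form (a b : A) : D.dOne (a • D.d b) = D.wedge (tmulA A E (D.d a) (D.d b)) := by
  -- The tensor `0` represents `d(db) = 0`, so only `da ∧ db` survives in the Leibniz rule.
  rw [D.isExteriorDerivative_dOne.left_leibniz a (D.d b) 0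
    (by rw [map_zero, D.isExteriorDerivative_dOne.d_d]), map_zero, map_zero, add_zero]

/-- The Maurer–Cartan equation `d ω(b) = - ω(b₍₁₎) ∧ ω(b₍₂₎)`. -/
lemma dOne_maurerCartan (b : A) : D.dOne (D.maurerCartan b) =
    - D.wedge (TensorProduct.lift
        ((tmulA A E).compl₁₂ D.maurerCartan D.maurerCartan) (comul b)) := by
  -- `d(S(b₁) db₂) = dS(b₁) ∧ db₂ = dS(b₁) ∧ b₂ ω(b₃)`. By Leibniz `dS(b₁) b₂ = d(S(b₁) b₂) - S(b₁)
  -- db₂`, where the first term is `d` of a constant and the second is the Maurer–Cartan form.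
  let J : A ⊗[ℂ] (A ⊗[ℂ] A) →ₗ[ℂ] TensorSq A E :=
    TensorProduct.lift ((tmulA A E).compl₁₂ (D.d ∘ₗ antipode ℂ)
      (actL ∘ₗ D.maurerCartan.lTensor A))
  have hJ : ∀ x u, J (x ⊗ₜ u) =
      tmulA A E (D.d (antipode ℂ x)) (actL (D.maurerCartan.lTensor A u)) := fun _ _ => rfl
  have h₁ : ∀ u : A ⊗[ℂ] A, D.dOne (actL ((antipode ℂ).rTensor E (D.d.lTensor A u))) =
      D.wedge (J (comul.lTensor A u)) := fun u => by
    induction u with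
    | zero => simp
    | add x y hx hy => simp only [map_add, hx, hy]
    | tmul x y =>
      simp only [LinearMap.lTensor_tmul, LinearMap.rTensor_tmul, actL_tmul, dOne_form, hJ,
        actL_maurerCartan]
  have h₂ : ∀ (v : A ⊗[ℂ] A) (z : A), J (TensorProduct.assoc ℂ A A A (v ⊗ₜ z)) =
      tmulA A E (D.d (LinearMap.mul' ℂ A ((antipode ℂ).rTensor A v))) (D.maurerCartan z) -
        tmulA A E (actL ((antipode ℂ).rTensor E (D.d.lTensor A v))) (D.maurerCartan z) :=
    fun v z => by
      induction v with
      | zero => simp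
      | add x y hx hy =>
        simp only [map_add, TensorProduct.add_tmul, hx, hy, LinearMap.add_apply]; abel
      | tmul x y => simp [hJ, D.leibniz, tmulA_balanced]
  have h₃ : ∀ u : A ⊗[ℂ] A, J (TensorProduct.assoc ℂ A A A (comul.rTensor A u)) =
      - TensorProduct.lift ((tmulA A E).compl₁₂ D.maurerCartan D.maurerCartan) u := fun u => by
    induction u with
    | zero => simp
    | add x y hx hy => simp only [map_add, hx, hy, neg_add]
    | tmul x y =>
      rw [LinearMap.rTensor_tmul, h₂, ← coactL_d, ← projL_apply]
      simp [Algebra.algebraMap_eq_smul_one, d_one, maurerCartan_apply]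
  rw [maurerCartan_apply, projL_apply, coactL_d, h₁, ← coassoc_apply, h₃, map_neg]

end BicovariantCalculus

namespace BicovariantCalculus

/-! ### The diagonal coactions on `E ⊗_A E`. -/

@[simp] lemma pairL_tmul (a c : A) (ρ ν : E) :
    pairL (a ⊗ₜ[ℂ] ρ) (c ⊗ₜ[ℂ] ν) = (a * c) ⊗ₜ tmulA A E ρ ν := rfl

@[simp] lemma pairR_tmul (a c : A) (ρ ν : E) :
    pairR (ρ ⊗ₜ[ℂ] a) (ν ⊗ₜ[ℂ] c) = tmulA A E ρ ν ⊗ₜ (a * c) := rfl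

lemma rmulAE_mul (x y : A ⊗[ℂ] A) (z : A ⊗[ℂ] E) :
    rmulAE A E (x * y) z = rmulAE A E y (rmulAE A E x z) := by
  induction z with
  | zero => simp
  | add u v hu hv => simp [hu, hv]
  | tmul c ρ =>
    induction x with
    | zero => simp
    | add u v hu hv => simp [add_mul, hu, hv]
    | tmul a b =>
      induction y with
      | zero => simp
      | add u v hu hv => simp [mul_add, hu, hv]
      | tmul a' b' => simp [mul_assoc, mul_smul]

lemma rmulAE_one (z : A ⊗[ℂ] E) : rmulAE A E 1 z = z := by
  induction z with
  | zero => simp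
  | add x y hx hy => simp [hx, hy]
  | tmul c ν => simp [Algebra.TensorProduct.one_def]

variable (D : BicovariantCalculus A E)

@[simp] lemma coactLT_tmulA (ρ ν : E) :
    D.coactLT (tmulA A E ρ ν) = pairL (D.coactL ρ) (D.coactL ν) := rfl

@[simp] lemma coactRT_tmulA (ρ ν : E) :
    D.coactRT (tmulA A E ρ ν) = pairR (D.coactR ρ) (D.coactR ν) := rfl

/-! ### Values of an invariant metric on invariant forms -/

lemma metric_rightInv {g : TensorSq A E →ₗ[ℂ] A} (hginv : D.IsBiinvariant g) {η η' : E}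
    (h : η ∈ D.rightInv) (h' : η' ∈ D.rightInv) :
    g (tmulA A E η η') = algebraMap ℂ A (counit (g (tmulA A E η η'))) := by
  have := hginv.right η η'
  simp only [coactRT_tmulA, D.mem_rightInv.1 h, D.mem_rightInv.1 h', pairR_tmul, mul_one,
    LinearMap.rTensor_tmul, TensorProduct.lid_tmul, LinearMap.comp_apply] at this
  rw [Algebra.algebraMap_eq_smul_one, this]

lemma metric_leftInv {g : TensorSq A E →ₗ[ℂ] A} (hginv : D.IsBiinvariant g) {ω ω' : E}
    (h : ω ∈ D.leftInv) (h' : ω' ∈ D.leftInv) :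
    g (tmulA A E ω ω') = algebraMap ℂ A (counit (g (tmulA A E ω ω'))) := by
  have := hginv.left ω ω'
  simp only [coactLT_tmulA, D.mem_leftInv.1 h, D.mem_leftInv.1 h', pairL_tmul, mul_one,
    LinearMap.lTensor_tmul, TensorProduct.rid_tmul, LinearMap.comp_apply] at this
  rw [Algebra.algebraMap_eq_smul_one, this]

/-! ### Coordinates with respect to a basis of right-invariant forms -/

/-- The projection onto the right-invariant forms, with values in `E₀`. -/
def projR' : E →ₗ[ℂ] D.rightInv := D.projR.codRestrict _ D.projR_mem

lemma projR'_coe (η : D.rightInv) : D.projR' (η : E) = η :=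
  Subtype.ext (D.projR_of_mem η.2)

lemma projR'_projR (ρ : E) : D.projR' (D.projR ρ) = D.projR' ρ :=
  Subtype.ext (D.projR_of_mem (D.projR_mem ρ))

section Basis

variable {ι : Type*} [Fintype ι] [DecidableEq ι] (b : Module.Basis ι ℂ D.rightInv)

/-- The functional on `E` that is the `j`-th coordinate of the right-invariant projection. -/
def coordFun (j : ι) : E →ₗ[ℂ] ℂ := b.coord j ∘ₗ D.projR'

lemma coordFun_basis (i j : ι) : D.coordFun b j (b i) = if i = j then 1 else 0 := by
  simp [coordFun, projR'_coe, Finsupp.single_apply]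

lemma coordFun_projR (j : ι) (ρ : E) : D.coordFun b j (D.projR ρ) = D.coordFun b j ρ := by
  simp [coordFun, projR'_projR]

lemma projR_eq_sum (ρ : E) : D.projR ρ = ∑ j, D.coordFun b j ρ • (b j : E) := by
  calc D.projR ρ = ((∑ j, b.repr (D.projR' ρ) j • b j : D.rightInv) : E) := by
        rw [b.sum_repr]; rfl
    _ = _ := by simp only [AddSubmonoidClass.coe_finsetSum, SetLike.val_smul]; rfl

/-- The right `A`-module coordinates of a form with respect to a basis of `E₀`. -/
def rightCoord (j : ι) : E →ₗ[ℂ] A :=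
  (TensorProduct.lid ℂ A).toLinearMap ∘ₗ (D.coordFun b j).rTensor A ∘ₗ D.trivR

lemma rightCoord_apply (j : ι) (ρ : E) : D.rightCoord b j ρ =
    TensorProduct.lid ℂ A ((D.coordFun b j).rTensor A (D.trivR ρ)) := rfl

lemma rightCoord_op_smul (j : ι) (a : A) (ρ : E) :
    D.rightCoord b j (MulOpposite.op a • ρ) = D.rightCoord b j ρ * a := by
  rw [rightCoord_apply, rightCoord_apply, trivR_op_smul]
  induction D.trivR ρ with
  | zero => simp
  | add x y hx hy => simp [hx, hy, add_mul]
  | tmul ν c => simp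

lemma rightCoord_basis (i j : ι) : D.rightCoord b j (b i) = if i = j then 1 else 0 := by
  rw [rightCoord_apply, D.trivR_of_mem (b i).2]
  simp [coordFun_basis]

lemma sum_rightCoord (ρ : E) :
    ∑ j, MulOpposite.op (D.rightCoord b j ρ) • (b j : E) = ρ := by
  have h : ∀ z : E ⊗[ℂ] A, ∑ j, MulOpposite.op (TensorProduct.lid ℂ A
      ((D.coordFun b j).rTensor A (D.projR.rTensor A z))) • (b j : E) =
      actR (D.projR.rTensor A z) := fun z => by
    induction z with
    | zero => simp
    | add x y hx hy => simp [add_smul, Finset.sum_add_distrib, hx, hy]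
    | tmul ν c =>
      simp only [LinearMap.rTensor_tmul, TensorProduct.lid_tmul, actR_tmul, coordFun_projR]
      rw [D.projR_eq_sum b ν, Finset.smul_sum]
      exact Finset.sum_congr rfl fun j _ => by rw [op_smul_complex, right_smul_complex]
  conv_rhs => rw [← D.actR_trivR ρ, trivR_apply, ← h]
  rfl

/-- The matrix of the left coaction on `E₀`. -/
def coactMatrix : Matrix ι ι A := fun i j =>
  TensorProduct.rid ℂ A ((D.coordFun b j).lTensor A (D.coactL (b i)))

/-- The left coaction of a right-invariant form lies in `A ⊗ E₀`, so its second leg can be expanded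
in the basis. -/
lemma coactL_basis (i : ι) : D.coactL (b i) = ∑ j, D.coactMatrix b i j ⊗ₜ (b j : E) := by
  have h : ∀ z : A ⊗[ℂ] E, D.projR.lTensor A z =
      ∑ j, TensorProduct.rid ℂ A ((D.coordFun b j).lTensor A z) ⊗ₜ (b j : E) := fun z => by
    induction z with
    | zero => simp
    | add x y hx hy => simp [TensorProduct.add_tmul, Finset.sum_add_distrib, hx, hy]
    | tmul c ν =>
      simp only [LinearMap.lTensor_tmul, TensorProduct.rid_tmul]
      rw [D.projR_eq_sum b ν, TensorProduct.tmul_sum]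
      exact Finset.sum_congr rfl fun j _ => by rw [TensorProduct.smul_tmul]
  rw [← D.projR_lTensor_coactL (b i).2, h]
  rfl

lemma comul_coactMatrix (i j : ι) : comul (R := ℂ) (D.coactMatrix b i j) =
    ∑ k, D.coactMatrix b i k ⊗ₜ D.coactMatrix b k j := by
  have h := congrArg (((TensorProduct.rid ℂ A).toLinearMap ∘ₗ
    (D.coordFun b j).lTensor A).lTensor A) (D.coactL_coassoc (b i))
  have h₂ : ∀ (u : A ⊗[ℂ] A) (ν : E), (((TensorProduct.rid ℂ A).toLinearMap ∘ₗ
      (D.coordFun b j).lTensor A).lTensor A) (TensorProduct.assoc ℂ A A E (u ⊗ₜ ν)) =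
      D.coordFun b j ν • u := fun u ν => by
    induction u with
    | zero => simp
    | add x y hx hy => simp [TensorProduct.add_tmul, hx, hy]
    | tmul x y => simp
  simp only [coactL_basis, map_sum, LinearMap.rTensor_tmul, LinearMap.lTensor_tmul, h₂,
    coordFun_basis, ite_smul, one_smul, zero_smul, Finset.sum_ite_eq', Finset.mem_univ,
    if_true, LinearMap.comp_apply, LinearEquiv.coe_coe, TensorProduct.rid_tmul] at h
  exact h

lemma counit_coactMatrix (i j : ι) :
    counit (R := ℂ) (D.coactMatrix b i j) = if i = j then 1 else 0 := by
  have h := congrArg (D.coordFun b j) (D.coactL_counit (b i))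
  simpa [coactL_basis, coordFun_basis] using h

/-- The antipode axiom for the entries of a corepresentation matrix. It provides only a left inverse
of the matrix `v`, whereas a right basis of left-invariant forms needs an inverse of `vᵀ`. -/
lemma antipode_mul_coactMatrix :
    (D.coactMatrix b).map (antipode ℂ) * D.coactMatrix b = 1 := by
  ext i j
  have h := mul_antipode_rTensor_comul_apply (R := ℂ) (D.coactMatrix b i j)
  rw [comul_coactMatrix, counit_coactMatrix] at h
  simp only [map_sum, LinearMap.rTensor_tmul, LinearMap.mul'_apply] at h
  rw [Matrix.mul_apply, Matrix.one_apply]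
  simp only [Matrix.map_apply]
  rw [h]
  split_ifs <;> simp

/-- The Gram matrix of a metric on the right-invariant forms. -/
def gramMatrix (g : TensorSq A E →ₗ[ℂ] A) : Matrix ι ι ℂ := fun i j =>
  counit (g (tmulA A E (b i) (b j)))

/-- A row vector killed by the Gram matrix gives a combination `ρ` of the basis forms with `g(ρ ⊗
ηⱼ) = 0` for all `j`. As `g` is right linear and the `ηⱼ` generate `E` on the right, nondegeneracy
forces `ρ = 0`. -/
lemma isUnit_gramMatrix {g : TensorSq A E →ₗ[ℂ] A} (hg : D.IsMetric g)
    (hginv : D.IsBiinvariant g) : IsUnit (D.gramMatrix b g) := by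
  rw [← Matrix.vecMul_injective_iff_isUnit]
  rw [← Matrix.coe_vecMulLinear, ← LinearMap.ker_eq_bot, LinearMap.ker_eq_bot']
  intro v hv
  have hρ : ∑ i, v i • (b i : E) = 0 := by
    refine hg.nondegenerate _ fun ν => ?_
    rw [← D.sum_rightCoord b ν, map_sum, map_sum]
    refine Finset.sum_eq_zero fun j _ => ?_
    have hj := congrFun hv j
    simp only [Matrix.vecMulLinear_apply, Matrix.vecMul, dotProduct, gramMatrix,
      Pi.zero_apply] at hj
    have hz : g (tmulA A E (∑ i, v i • (b i : E)) (b j)) =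
        ∑ i, v i • algebraMap ℂ A (counit (g (tmulA A E (b i) (b j)))) := by
      simp only [LinearMap.sum_apply, map_smul, LinearMap.smul_apply, map_sum]
      exact Finset.sum_congr rfl fun i _ => by
        rw [← D.metric_rightInv hginv (b i).2 (b j).2]
    rw [← rmulT_tmulA, hg.map_rmul, hz]
    simp only [Algebra.algebraMap_eq_smul_one, smul_smul, ← Finset.sum_smul, hj, zero_smul,
      zero_mul]
  have hb : ∑ i, v i • b i = 0 := Subtype.ext (by simpa using hρ)
  exact funext (Fintype.linearIndependent_iff.1 b.linearIndependent v hb)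

/-- Left invariance of `g`, written in the basis of `E₀`; the Gram entries are scalars and commute
with the entries of the coaction matrix. -/
lemma coactMatrix_gramMatrix {g : TensorSq A E →ₗ[ℂ] A} (hginv : D.IsBiinvariant g) :
    D.coactMatrix b * (D.gramMatrix b g).map (algebraMap ℂ A) * (D.coactMatrix b).transpose =
      (D.gramMatrix b g).map (algebraMap ℂ A) := by
  ext i j
  have h := hginv.left (b i) (b j)
  rw [D.metric_rightInv hginv (b i).2 (b j).2] at h
  simp only [coactLT_tmulA, coactL_basis, map_sum, LinearMap.sum_apply, pairL_tmul,
    LinearMap.lTensor_tmul, TensorProduct.rid_tmul, LinearMap.comp_apply] at h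
  simp only [Matrix.mul_apply, Matrix.map_apply, Matrix.transpose_apply, Finset.sum_mul]
  rw [gramMatrix, ← h]
  refine Finset.sum_congr rfl fun k _ => Finset.sum_congr rfl fun l _ => ?_
  rw [Algebra.smul_def, ← mul_assoc, Algebra.commutes]
  rfl

/-- The inverse transpose of the coaction matrix, for an invariant metric. -/
def dualMatrix (g : TensorSq A E →ₗ[ℂ] A) : Matrix ι ι A :=
  (D.gramMatrix b g)⁻¹.map (algebraMap ℂ A) * D.coactMatrix b *
    (D.gramMatrix b g).map (algebraMap ℂ A)

variable {g : TensorSq A E →ₗ[ℂ] A}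

lemma gramMatrix_map_inv_mul (hg : D.IsMetric g) (hginv : D.IsBiinvariant g) :
    (D.gramMatrix b g)⁻¹.map (algebraMap ℂ A) *
    (D.gramMatrix b g).map (algebraMap ℂ A) = 1 := by
  rw [← Matrix.map_mul, Matrix.nonsing_inv_mul _
    ((Matrix.isUnit_iff_isUnit_det _).1 (D.isUnit_gramMatrix b hg hginv))]
  simp

lemma gramMatrix_map_mul_inv (hg : D.IsMetric g) (hginv : D.IsBiinvariant g) :
    (D.gramMatrix b g).map (algebraMap ℂ A) *
    (D.gramMatrix b g)⁻¹.map (algebraMap ℂ A) = 1 := by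
  rw [← Matrix.map_mul, Matrix.mul_nonsing_inv _
    ((Matrix.isUnit_iff_isUnit_det _).1 (D.isUnit_gramMatrix b hg hginv))]
  simp

lemma dualMatrix_mul_transpose (hg : D.IsMetric g) (hginv : D.IsBiinvariant g) :
    D.dualMatrix b g * (D.coactMatrix b).transpose = 1 := by
  rw [dualMatrix, Matrix.mul_assoc, Matrix.mul_assoc, ← Matrix.mul_assoc (D.coactMatrix b),
    D.coactMatrix_gramMatrix b hginv, D.gramMatrix_map_inv_mul b hg hginv]

/-- A one-sided inverse over the noncommutative `A` need not be two-sided. Multiplying `v G vᵀ = G`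
by `G⁻¹ S(v)` on the left and using `S(v) v = 1` gives `vᵀ = G⁻¹ S(v) G`, whose product with `G⁻¹ v
G` is `1`. -/
lemma transpose_mul_dualMatrix (hg : D.IsMetric g) (hginv : D.IsBiinvariant g) :
    (D.coactMatrix b).transpose * D.dualMatrix b g = 1 := by
  have h : (D.coactMatrix b).transpose = (D.gramMatrix b g)⁻¹.map (algebraMap ℂ A) *
      (D.coactMatrix b).map (antipode ℂ) * (D.gramMatrix b g).map (algebraMap ℂ A) := by
    conv_rhs => rw [← D.coactMatrix_gramMatrix b hginv]
    rw [Matrix.mul_assoc, Matrix.mul_assoc (D.coactMatrix b), ← Matrix.mul_assoc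
      ((D.coactMatrix b).map _), antipode_mul_coactMatrix, Matrix.one_mul, ← Matrix.mul_assoc,
      D.gramMatrix_map_inv_mul b hg hginv, Matrix.one_mul]
  rw [h, dualMatrix, Matrix.mul_assoc, ← Matrix.mul_assoc ((D.gramMatrix b g).map _),
    ← Matrix.mul_assoc ((D.gramMatrix b g).map _), D.gramMatrix_map_mul_inv b hg hginv,
    Matrix.one_mul, Matrix.mul_assoc, ← Matrix.mul_assoc ((D.coactMatrix b).map _),
    antipode_mul_coactMatrix, Matrix.one_mul, D.gramMatrix_map_inv_mul b hg hginv]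

/-- The form `∑ i, ηᵢ Tᵢⱼ`, with `T` the dual matrix. -/
def invForm (g : TensorSq A E →ₗ[ℂ] A) (j : ι) : E :=
  ∑ i, MulOpposite.op (D.dualMatrix b g i j) • (b i : E)

lemma sum_op_smul_invForm (hg : D.IsMetric g) (hginv : D.IsBiinvariant g) (j : ι) :
    ∑ i, MulOpposite.op (D.coactMatrix b j i) • D.invForm b g i = b j := by
  have h : ∀ k, ∑ i, D.dualMatrix b g k i * D.coactMatrix b j i = if k = j then 1 else 0 :=
    fun k => by
      have := congrFun₂ (D.dualMatrix_mul_transpose b hg hginv) k j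
      simpa [Matrix.mul_apply, Matrix.one_apply] using this
  simp only [invForm, Finset.smul_sum, smul_smul, ← MulOpposite.op_mul]
  rw [Finset.sum_comm]
  simp only [← Finset.sum_smul, ← Finset.op_sum, h]
  simp [apply_ite MulOpposite.op]

/-- Coacting on `ηₖ = ∑ ωᵢ vₖᵢ` shows that the families `Δ_E(ωᵢ)` and `1 ⊗ ωᵢ` agree after
multiplication on the right by the matrix `Δ(vₖᵢ)` and summation over `i`. Multiplication by `Δ` of
the dual matrix undoes this, by `transpose_mul_dualMatrix`. -/
lemma invForm_mem (hg : D.IsMetric g) (hginv : D.IsBiinvariant g) (j : ι) :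
    D.invForm b g j ∈ D.leftInv := by
  have h₁ : ∀ k, ∑ i, rmulAE A E (comul (D.coactMatrix b k i)) (D.coactL (D.invForm b g i)) =
      ∑ i, rmulAE A E (comul (D.coactMatrix b k i)) (1 ⊗ₜ D.invForm b g i) := fun k => by
    simp only [← coactL_op_smul, ← map_sum, D.sum_op_smul_invForm b hg hginv]
    rw [coactL_basis]
    simp only [comul_coactMatrix, map_sum, LinearMap.sum_apply, rmulAE_tmul, one_mul]
    rw [Finset.sum_comm]
    simp only [← TensorProduct.tmul_sum, D.sum_op_smul_invForm b hg hginv]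
  have h₂ : ∀ i, ∑ k, D.coactMatrix b k i * D.dualMatrix b g k j = if i = j then 1 else 0 :=
    fun i => by
      have := congrFun₂ (D.transpose_mul_dualMatrix b hg hginv) i j
      simpa [Matrix.mul_apply, Matrix.one_apply] using this
  have h₃ : ∀ X : ι → A ⊗[ℂ] E, X j = ∑ k, rmulAE A E (comul (D.dualMatrix b g k j))
      (∑ i, rmulAE A E (comul (D.coactMatrix b k i)) (X i)) := fun X => by
    simp only [map_sum, ← rmulAE_mul, ← Bialgebra.comul_mul]
    rw [Finset.sum_comm]
    simp only [← LinearMap.sum_apply, ← map_sum, h₂]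
    simp [apply_ite, ite_apply, rmulAE_one]
  rw [mem_leftInv, h₃ fun i => D.coactL (D.invForm b g i), h₃ fun i => 1 ⊗ₜ D.invForm b g i]
  simp only [h₁]

/-- Right coordinates with respect to the forms `invForm`. -/
def invCoord (i : ι) : E →ₗ[ℂ] A :=
  ∑ j, LinearMap.mulLeft ℂ (D.coactMatrix b j i) ∘ₗ D.rightCoord b j

lemma invCoord_apply (i : ι) (ρ : E) :
    D.invCoord b i ρ = ∑ j, D.coactMatrix b j i * D.rightCoord b j ρ := by
  simp [invCoord]

lemma invCoord_op_smul (i : ι) (a : A) (ρ : E) :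
    D.invCoord b i (MulOpposite.op a • ρ) = D.invCoord b i ρ * a := by
  simp [invCoord_apply, rightCoord_op_smul, Finset.sum_mul, mul_assoc]

lemma invCoord_invForm (hg : D.IsMetric g) (hginv : D.IsBiinvariant g) (i j : ι) :
    D.invCoord b i (D.invForm b g j) = if i = j then 1 else 0 := by
  have := congrFun₂ (D.transpose_mul_dualMatrix b hg hginv) i j
  simpa [Matrix.mul_apply, Matrix.one_apply, invCoord_apply, invForm, rightCoord_op_smul,
    rightCoord_basis] using this

lemma sum_invCoord (hg : D.IsMetric g) (hginv : D.IsBiinvariant g) (ρ : E) :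
    ∑ i, MulOpposite.op (D.invCoord b i ρ) • D.invForm b g i = ρ := by
  conv_rhs => rw [← D.sum_rightCoord b ρ]
  simp only [← D.sum_op_smul_invForm b hg hginv, invCoord_apply, Finset.op_sum,
    Finset.sum_smul, Finset.smul_sum, smul_smul, ← MulOpposite.op_mul]
  rw [Finset.sum_comm]

/-- On `ωⱼ a` the coaction is `a₁ ⊗ ωⱼ a₂`, so applying `ε` of the coordinate returns `δᵢⱼ a`.
Consequently the coordinates of a left-invariant form are scalars. -/
lemma counit_invCoord (hg : D.IsMetric g) (hginv : D.IsBiinvariant g) (i : ι) (ρ : E) :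
    TensorProduct.rid ℂ A ((counit ∘ₗ D.invCoord b i).lTensor A (D.coactL ρ)) = D.invCoord b i ρ := by
  rw [← D.sum_invCoord b hg hginv ρ]
  simp only [map_sum]
  refine Finset.sum_congr rfl fun j _ => ?_
  rw [coactL_op_smul, D.mem_leftInv.1 (D.invForm_mem b hg hginv j), invCoord_op_smul,
    D.invCoord_invForm b hg hginv]
  have h : ∀ u : A ⊗[ℂ] A, TensorProduct.rid ℂ A ((counit ∘ₗ D.invCoord b i).lTensor A
      (rmulAE A E u (1 ⊗ₜ D.invForm b g j))) =
      (if i = j then 1 else 0) * TensorProduct.rid ℂ A (counit.lTensor A u) := fun u => by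
    induction u with
    | zero => simp
    | add x y hx hy => simp only [map_add, LinearMap.add_apply, hx, hy, mul_add]
    | tmul x y =>
      simp only [rmulAE_tmul, LinearMap.lTensor_tmul, LinearMap.comp_apply, invCoord_op_smul,
        D.invCoord_invForm b hg hginv]
      split_ifs <;> simp
  rw [h]
  simp

lemma invCoord_of_mem (hg : D.IsMetric g) (hginv : D.IsBiinvariant g) (i : ι)
    {ω : E} (h : ω ∈ D.leftInv) :
    D.invCoord b i ω = algebraMap ℂ A (counit (D.invCoord b i ω)) := by
  have := D.counit_invCoord b hg hginv i ω
  rw [D.mem_leftInv.1 h] at this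
  simpa [Algebra.algebraMap_eq_smul_one] using this.symm

end Basis

/-- In the presence of a bi-invariant metric, multiplication `₀E ⊗ A → E` is bijective. -/
lemma exists_rightTrivialisation [FiniteDimensional ℂ D.rightInv] {g : TensorSq A E →ₗ[ℂ] A}
    (hg : D.IsMetric g) (hginv : D.IsBiinvariant g) :
    ∃ Ψ : E →ₗ[ℂ] D.leftInv ⊗[ℂ] A,
      (∀ ρ, actR (D.leftInv.subtype.rTensor A (Ψ ρ)) = ρ) ∧
        ∀ (ω : D.leftInv) (a : A), Ψ (MulOpposite.op a • (ω : E)) = ω ⊗ₜ a := by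
  classical
  let b := Module.finBasis ℂ D.rightInv
  let w : Fin _ → D.leftInv := fun i => ⟨D.invForm b g i, D.invForm_mem b hg hginv i⟩
  refine ⟨∑ i, TensorProduct.mk ℂ D.leftInv A (w i) ∘ₗ D.invCoord b i, fun ρ => ?_,
    fun ω a => ?_⟩
  · conv_rhs => rw [← D.sum_invCoord b hg hginv ρ]
    simp [w]
  -- Scalar coordinates mean that the `w i` already span `₀E` over `ℂ`; this lets the coefficients
  -- pass across `⊗`.
  · have hω : ω = ∑ i, counit (R := ℂ) (D.invCoord b i ω) • w i := by
      apply Subtype.ext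
      conv_lhs => rw [← D.sum_invCoord b hg hginv ω]
      simp only [AddSubmonoidClass.coe_finsetSum, SetLike.val_smul, w]
      refine Finset.sum_congr rfl fun i _ => ?_
      rw [D.invCoord_of_mem b hg hginv i ω.2, op_algebraMap_smul, Bialgebra.counit_algebraMap]
    conv_rhs => rw [hω, TensorProduct.sum_tmul]
    simp only [LinearMap.sum_apply, LinearMap.comp_apply, TensorProduct.mk_apply]
    refine Finset.sum_congr rfl fun i _ => ?_
    rw [invCoord_op_smul, D.invCoord_of_mem b hg hginv i ω.2, Algebra.algebraMap_eq_smul_one,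
      smul_mul_assoc, one_mul, ← TensorProduct.smul_tmul, map_smul, Bialgebra.counit_one,
      smul_eq_mul, mul_one]

end BicovariantCalculus

/-! ### Right multiplication on `E ⊗_A E` and its coaction. -/

lemma rmulT_add (a b : A) (x : TensorSq A E) :
    rmulT A E (a + b) x = rmulT A E a x + rmulT A E b x := by
  induction x using tensorSq_induction with
  | zero => simp
  | add x y hx hy => simp only [map_add, hx, hy]; abel
  | tmul ρ ν => simp [add_smul]

lemma rmulT_smul (c : ℂ) (a : A) (x : TensorSq A E) :
    rmulT A E (c • a) x = c • rmulT A E a x := by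
  induction x using tensorSq_induction with
  | zero => simp
  | add x y hx hy => simp [map_add, hx, hy]
  | tmul ρ ν => simp

lemma rmulT_mul (a b : A) (x : TensorSq A E) :
    rmulT A E (a * b) x = rmulT A E b (rmulT A E a x) := by
  induction x using tensorSq_induction with
  | zero => simp
  | add x y hx hy => simp [map_add, hx, hy]
  | tmul ρ ν => simp [mul_smul]

lemma rmulT_one (x : TensorSq A E) : rmulT A E 1 x = x := by
  induction x using tensorSq_induction with
  | zero => simp
  | add x y hx hy => simp [map_add, hx, hy]
  | tmul ρ ν => simp

variable (A E) in
/-- Right multiplication on `E ⊗_A E` as a bilinear map. -/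
def rmulTHom : A →ₗ[ℂ] TensorSq A E →ₗ[ℂ] TensorSq A E where
  toFun := rmulT A E
  map_add' a b := LinearMap.ext (rmulT_add a b)
  map_smul' c a := LinearMap.ext (rmulT_smul c a)

@[simp] lemma rmulTHom_apply (a : A) (x : TensorSq A E) :
    rmulTHom A E a x = rmulT A E a x := rfl

/-- `(b ⊗ x) (a ⊗ a') = b a ⊗ x a'` on `A ⊗ (E ⊗_A E)`, with the acting element first. -/
def rmulAT : A ⊗[ℂ] A →ₗ[ℂ] A ⊗[ℂ] TensorSq A E →ₗ[ℂ] A ⊗[ℂ] TensorSq A E :=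
  TensorProduct.map₂ (LinearMap.mul ℂ A).flip (rmulTHom A E)

@[simp] lemma rmulAT_tmul (a a' b : A) (x : TensorSq A E) :
    rmulAT (a ⊗ₜ a') (b ⊗ₜ x) = (b * a) ⊗ₜ rmulT A E a' x := rfl

namespace BicovariantCalculus

lemma pairL_rmulAE (u : A ⊗[ℂ] A) (y z : A ⊗[ℂ] E) :
    pairL y (rmulAE A E u z) = rmulAT u (pairL y z) := by
  induction u with
  | zero => simp
  | add u v hu hv => simp [hu, hv]
  | tmul a a' =>
    induction z with
    | zero => simp
    | add u v hu hv => simp [hu, hv]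
    | tmul c ρ =>
      induction y with
      | zero => simp
      | add u v hu hv => simp only [map_add, LinearMap.add_apply, hu, hv]
      | tmul b ν => simp [mul_assoc]

variable (D : BicovariantCalculus A E)

lemma coactLT_rmulT (a : A) (x : TensorSq A E) :
    D.coactLT (rmulT A E a x) = rmulAT (comul a) (D.coactLT x) := by
  induction x using tensorSq_induction with
  | zero => simp
  | add x y hx hy => simp [map_add, hx, hy]
  | tmul ρ ν => simp [coactL_op_smul, pairL_rmulAE]

/-! ### Left-invariant two-tensors and differentials of left-invariant forms. -/

@[simp] lemma invSqMap_tmul (ω ω' : D.leftInv) :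
    D.invSqMap (ω ⊗ₜ ω') = tmulA A E ω ω' := rfl

lemma coactLT_invSqMap (x : D.InvSq) : D.coactLT (D.invSqMap x) = 1 ⊗ₜ D.invSqMap x := by
  induction x using TensorProduct.induction_on with
  | zero => simp
  | add x y hx hy => simp [hx, hy, TensorProduct.tmul_add]
  | tmul ω ω' => simp [D.mem_leftInv.1 ω.2, D.mem_leftInv.1 ω'.2]

lemma braidInv_projL_mem (ω : E) (z : E ⊗[ℂ] A) :
    D.braidInv ω (D.projL.rTensor A z) ∈ LinearMap.range D.invSqMap := by
  induction z with
  | zero => simp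
  | add x y hx hy => simpa only [map_add] using add_mem hx hy
  | tmul ν y => exact ⟨⟨_, D.projL_mem ν⟩ ⊗ₜ ⟨_, D.projL_mem _⟩, rfl⟩

/-- In `σ(ω ⊗ ω') = ω'₀ ⊗ P(ω ω'₁)` the second factor is left-invariant by construction, and the
first because the right coaction preserves `₀E`. -/
lemma braiding_invSqMap_mem (x : D.InvSq) :
    D.braiding (D.invSqMap x) ∈ LinearMap.range D.invSqMap := by
  induction x using TensorProduct.induction_on with
  | zero => simp
  | add x y hx hy => simpa only [map_add] using add_mem hx hy
  | tmul ω ω' =>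
    rw [invSqMap_tmul, D.braiding_tmulA_of_mem ω.2, ← D.projL_rTensor_coactR ω'.2]
    exact D.braidInv_projL_mem _ _

lemma metric_invSqMap {g : TensorSq A E →ₗ[ℂ] A} (hginv : D.IsBiinvariant g) (x : D.InvSq) :
    g (D.invSqMap x) = algebraMap ℂ A (counit (g (D.invSqMap x))) := by
  induction x using TensorProduct.induction_on with
  | zero => simp
  | add x y hx hy => simp only [map_add, ← hx, ← hy]
  | tmul ω ω' => exact D.metric_leftInv hginv ω.2 ω'.2

/-- Applying `projL` to `ω = ∑ aₖ dbₖ` replaces each `aₖ` by the scalar `ε(aₖ)`. The Maurer–Cartan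
equation therefore governs all of `₀E`. -/
lemma exists_maurerCartan_eq {ω : E} (h : ω ∈ D.leftInv) : ∃ b, D.maurerCartan b = ω := by
  obtain ⟨n, a, b, hab⟩ := D.exists_sum ω
  refine ⟨∑ k, counit (R := ℂ) (a k) • b k, ?_⟩
  conv_rhs => rw [← D.projL_of_mem h, hab]
  simp [projL_smul, maurerCartan_apply]

lemma dOne_mem {ω : E} (h : ω ∈ D.leftInv) :
    D.dOne ω ∈ LinearMap.range (D.wedge ∘ₗ D.invSqMap) := by
  obtain ⟨b, rfl⟩ := D.exists_maurerCartan_eq h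
  rw [dOne_maurerCartan, neg_mem_iff]
  induction (comul (R := ℂ) b : A ⊗[ℂ] A) with
  | zero => simp
  | add x y hx hy => simpa only [map_add] using add_mem hx hy
  | tmul x y => exact ⟨⟨_, D.maurerCartan_mem x⟩ ⊗ₜ ⟨_, D.maurerCartan_mem y⟩, rfl⟩

/-- A linear choice of invariant two-tensors representing `-dω`. -/
lemma exists_torsionless : ∃ N : D.leftInv →ₗ[ℂ] D.InvSq,
    ∀ ω : D.leftInv, D.wedge (D.invSqMap (N ω)) = - D.dOne ω := by
  obtain ⟨N, hN⟩ := Module.projective_lifting_property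
    (D.wedge ∘ₗ D.invSqMap).rangeRestrict
    (LinearMap.codRestrict (LinearMap.range (D.wedge ∘ₗ D.invSqMap))
      (-(D.dOne ∘ₗ D.leftInv.subtype)) fun ω => neg_mem (D.dOne_mem ω.2))
    (LinearMap.surjective_rangeRestrict _)
  exact ⟨N, fun ω => congrArg Subtype.val (LinearMap.congr_fun hN ω)⟩

/-! ### Consequences of the freeness of `E` as a right module over its left-invariant forms -/

/-- An inverse of the multiplication map `₀E ⊗ A → E`. -/
structure RightTrivialisation where
  map : E →ₗ[ℂ] D.leftInv ⊗[ℂ] A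
  actR_map : ∀ ρ, actR (D.leftInv.subtype.rTensor A (map ρ)) = ρ
  map_op_smul : ∀ (ω : D.leftInv) (a : A), map (MulOpposite.op a • (ω : E)) = ω ⊗ₜ a

namespace RightTrivialisation

variable {D} (Ψ : D.RightTrivialisation)

include Ψ in
lemma induction {p : E → Prop} (ρ : E) (zero : p 0)
    (add : ∀ ρ ν, p ρ → p ν → p (ρ + ν))
    (smul : ∀ (a : A) (ω : D.leftInv), p (MulOpposite.op a • (ω : E))) : p ρ := by
  rw [← Ψ.actR_map ρ]
  induction Ψ.map ρ with
  | zero => simpa using zero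
  | add x y hx hy => simpa using add _ _ hx hy
  | tmul ω a => simpa using smul a ω

lemma map_coe (ω : D.leftInv) : Ψ.map (ω : E) = ω ⊗ₜ 1 := by
  simpa using Ψ.map_op_smul ω 1

lemma map_mul (a : A) (ρ : E) :
    Ψ.map (MulOpposite.op a • ρ) = ((LinearMap.mul ℂ A).flip a).lTensor _ (Ψ.map ρ) := by
  induction ρ using Ψ.induction with
  | zero => simp
  | add x y hx hy => simp [hx, hy]
  | smul c ω => simp [smul_smul, ← MulOpposite.op_mul, map_op_smul]

/-- `(ω ⊗ a) ⊗ ν ↦ ω ⊗ aν`, followed by the trivialisation of the last factor. -/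
def preSq : (D.leftInv ⊗[ℂ] A) ⊗[ℂ] E →ₗ[ℂ] D.InvSq ⊗[ℂ] A :=
  (TensorProduct.assoc ℂ D.leftInv D.leftInv A).symm.toLinearMap ∘ₗ
    (Ψ.map ∘ₗ actL).lTensor D.leftInv ∘ₗ (TensorProduct.assoc ℂ D.leftInv A E).toLinearMap

lemma preSq_tmul (ω : D.leftInv) (a : A) (ν : E) : Ψ.preSq ((ω ⊗ₜ a) ⊗ₜ ν) =
    (TensorProduct.assoc ℂ D.leftInv D.leftInv A).symm (ω ⊗ₜ Ψ.map (a • ν)) := rfl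

/-- The inverse `E ⊗_A E → (₀E ⊗ ₀E) ⊗ A` of the multiplication map. -/
def mapSq : TensorSq A E →ₗ[ℂ] D.InvSq ⊗[ℂ] A :=
  liftA (A := A) (W := D.InvSq ⊗[ℂ] A)
    (((TensorProduct.mk ℂ (D.leftInv ⊗[ℂ] A) E).comp Ψ.map).compr₂ Ψ.preSq)
    fun a ρ ν => by
      simp only [LinearMap.compr₂_apply, LinearMap.comp_apply, TensorProduct.mk_apply, map_mul]
      induction Ψ.map ρ with
      | zero => simp
      | add x y hx hy => simp [TensorProduct.add_tmul, hx, hy]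
      | tmul ω c => simp [preSq_tmul, mul_smul]

lemma mapSq_rmulT (x : D.InvSq) (a : A) : Ψ.mapSq (rmulT A E a (D.invSqMap x)) = x ⊗ₜ a := by
  induction x using TensorProduct.induction_on with
  | zero => simp
  | add x y hx hy => simp [TensorProduct.add_tmul, hx, hy]
  | tmul ω ω' =>
    rw [invSqMap_tmul, rmulT_tmulA, mapSq, liftA_tmulA]
    simp [map_coe, preSq_tmul, map_op_smul]

include Ψ in
lemma induction_sq {p : TensorSq A E → Prop} (t : TensorSq A E) (zero : p 0)
    (add : ∀ x y, p x → p y → p (x + y))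
    (rmul : ∀ (a : A) (x : D.InvSq), p (rmulT A E a (D.invSqMap x))) : p t := by
  induction t using tensorSq_induction with
  | zero => exact zero
  | add x y hx hy => exact add x y hx hy
  | tmul ρ ν =>
    induction ρ using Ψ.induction with
    | zero => simpa using zero
    | add x y hx hy => simpa using add _ _ hx hy
    | smul c ω =>
      rw [tmulA_balanced]
      induction c • ν using Ψ.induction with
      | zero => simpa using zero
      | add x y hx hy => simpa using add _ _ hx hy
      | smul a ω' => exact rmul a (ω ⊗ₜ ω')

/-- A left inverse of `₀E ⊗ ₀E → E ⊗_A E`. -/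
def retract : TensorSq A E →ₗ[ℂ] D.InvSq :=
  (TensorProduct.rid ℂ D.InvSq).toLinearMap ∘ₗ counit.lTensor D.InvSq ∘ₗ Ψ.mapSq

lemma retract_rmulT (x : D.InvSq) (a : A) :
    Ψ.retract (rmulT A E a (D.invSqMap x)) = counit (R := ℂ) a • x := by
  simp [retract, mapSq_rmulT]

lemma retract_invSqMap (x : D.InvSq) : Ψ.retract (D.invSqMap x) = x := by
  simpa [rmulT_one] using Ψ.retract_rmulT x 1

include Ψ in
lemma invSqMap_injective : Function.Injective D.invSqMap :=
  Function.LeftInverse.injective Ψ.retract_invSqMap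

/-- A left-invariant two-tensor lies in `₀E ⊗ ₀E`. -/
lemma invSqMap_retract {t : TensorSq A E} (ht : D.coactLT t = 1 ⊗ₜ t) :
    D.invSqMap (Ψ.retract t) = t := by
  -- For `t = x a` the coaction is `a₁ ⊗ x a₂`, and `retract` sends `x a₂` to `ε(a₂) x`, so
  -- multiplying by `a₁` recovers `x a`. For left-invariant `t` the left side is just the retraction
  -- of `t`.
  have h : ∀ t, TensorProduct.lift (rmulTHom A E)
      ((D.invSqMap ∘ₗ Ψ.retract).lTensor A (D.coactLT t)) = t := fun t => by
    induction t using Ψ.induction_sq with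
    | zero => simp
    | add x y hx hy => simp only [map_add, hx, hy]
    | rmul a x =>
      rw [coactLT_rmulT, coactLT_invSqMap]
      have h : ∀ u : A ⊗[ℂ] A, TensorProduct.lift (rmulTHom A E)
          ((D.invSqMap ∘ₗ Ψ.retract).lTensor A (rmulAT u (1 ⊗ₜ D.invSqMap x))) =
          rmulT A E (TensorProduct.rid ℂ A (counit.lTensor A u)) (D.invSqMap x) := fun u => by
        induction u with
        | zero => simpa using (rmulT_smul (E := E) 0 (0 : A) _).symm
        | add x y hx hy => simp only [map_add, LinearMap.add_apply, hx, hy, rmulT_add]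
        | tmul x y => simp [retract_rmulT, rmulT_smul]
      rw [h]
      simp
  have := h t
  rw [ht] at this
  simpa [rmulT_one] using this

include Ψ in
-- The chosen lift has its defining property once some lift exists; composing with `retract`
-- supplies one.
lemma invSqMap_comp_toInvSq {W : Type*} [AddCommGroup W] [Module ℂ W]
    {f : W →ₗ[ℂ] TensorSq A E} (hf : ∀ w, f w ∈ LinearMap.range D.invSqMap) :
    D.invSqMap ∘ₗ D.toInvSq f = f := by
  refine Classical.epsilon_spec (p := fun F : W →ₗ[ℂ] D.InvSq => D.invSqMap ∘ₗ F = f)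
    ⟨Ψ.retract ∘ₗ f, ?_⟩
  ext w
  obtain ⟨x, hx⟩ := hf w
  simp [← hx, retract_invSqMap]

include Ψ in
lemma invSqMap_braiding₀ (x : D.InvSq) :
    D.invSqMap (D.braiding₀ x) = D.braiding (D.invSqMap x) :=
  LinearMap.congr_fun (Ψ.invSqMap_comp_toInvSq (f := D.braiding ∘ₗ D.invSqMap)
    fun w => D.braiding_invSqMap_mem w) x

include Ψ in
-- Injectivity of `invSqMap` turns the fixed-point equation for `σ` into one for `₀σ`. It identifies
-- the range of `psym₀`, defined by eigenspaces, with the symmetric tensors, defined by `∧`.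
lemma symSq_eq_eigenspace : D.symSq = D.braiding₀.eigenspace 1 := by
  ext x
  rw [symSq, LinearMap.mem_ker, LinearMap.comp_apply, wedge_eq_zero_iff,
    Module.End.mem_eigenspace_iff, one_smul, ← Ψ.invSqMap_braiding₀]
  exact Ψ.invSqMap_injective.eq_iff

/-! ### Connections determined by their values on left-invariant forms -/

/-- The connection with prescribed values on left-invariant forms. -/
def connection (N : D.leftInv →ₗ[ℂ] D.InvSq) : E →ₗ[ℂ] TensorSq A E :=
  TensorProduct.lift ((rmulTHom A E).flip ∘ₗ D.invSqMap ∘ₗ N +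
    (tmulA A E).compl₁₂ D.leftInv.subtype D.d) ∘ₗ Ψ.map

lemma connection_op_smul (N : D.leftInv →ₗ[ℂ] D.InvSq) (ω : D.leftInv) (a : A) :
    Ψ.connection N (MulOpposite.op a • (ω : E)) =
      rmulT A E a (D.invSqMap (N ω)) + tmulA A E ω (D.d a) := by
  simp [connection, map_op_smul]

lemma connection_coe (N : D.leftInv →ₗ[ℂ] D.InvSq) (ω : D.leftInv) :
    Ψ.connection N (ω : E) = D.invSqMap (N ω) := by
  simpa [rmulT_one, d_one] using Ψ.connection_op_smul N ω 1

lemma isConnection_connection (N : D.leftInv →ₗ[ℂ] D.InvSq) :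
    D.IsConnection (Ψ.connection N) := fun ρ a => by
  induction ρ using Ψ.induction with
  | zero => simp
  | add x y hx hy => simp only [smul_add, map_add, hx, hy, LinearMap.add_apply]; abel
  | smul c ω =>
    rw [smul_smul, ← MulOpposite.op_mul, connection_op_smul, connection_op_smul, rmulT_mul,
      D.leibniz, map_add, map_add, rmulT_tmulA, tmulA_balanced, add_assoc]

lemma isLeftCovariant_connection (N : D.leftInv →ₗ[ℂ] D.InvSq) :
    D.IsLeftCovariant (Ψ.connection N) := by
  ext ρ
  simp only [LinearMap.comp_apply]
  induction ρ using Ψ.induction with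
  | zero => simp
  | add x y hx hy => simp only [map_add, hx, hy]
  | smul a ω =>
    rw [connection_op_smul, map_add, coactLT_rmulT, coactLT_invSqMap, coactLT_tmulA,
      coactL_op_smul, D.mem_leftInv.1 ω.2, coactL_d]
    induction (comul (R := ℂ) a : A ⊗[ℂ] A) with
    | zero => simp
    | add x y hx hy => simp only [map_add, LinearMap.add_apply, hx, hy]; abel
    | tmul x y => simp [connection_op_smul, TensorProduct.tmul_add]

include Ψ in
lemma connection_ext {nabla nabla' : E →ₗ[ℂ] TensorSq A E} (h : D.IsConnection nabla)
    (h' : D.IsConnection nabla') (hn : ∀ ω : D.leftInv, nabla ω = nabla' ω) :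
    nabla = nabla' := by
  ext ρ
  induction ρ using Ψ.induction with
  | zero => simp
  | add x y hx hy => simp [hx, hy]
  | smul a ω => rw [h, h', hn]

include Ψ in
-- Left covariance evaluated at `ω` says precisely that `∇ω` is left-invariant.
lemma exists_invSqMap_eq {nabla : E →ₗ[ℂ] TensorSq A E} (h : D.IsLeftCovariant nabla) :
    ∃ N : D.leftInv →ₗ[ℂ] D.InvSq, ∀ ω : D.leftInv, nabla ω = D.invSqMap (N ω) := by
  refine ⟨Ψ.retract ∘ₗ nabla ∘ₗ D.leftInv.subtype, fun ω => ?_⟩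
  refine (Ψ.invSqMap_retract ?_).symm
  have := LinearMap.congr_fun h (ω : E)
  simp only [LinearMap.comp_apply, D.mem_leftInv.1 ω.2, LinearMap.lTensor_tmul] at this
  exact this.symm

include Ψ in
-- For a connection, `∧ ∘ ∇ + d` is right `A`-linear: the terms `ω ∧ da` and `-ω ∧ da` cancel. It
-- therefore vanishes once it vanishes on `₀E`, which generates `E` on the right.
lemma isTorsionless_iff {nabla : E →ₗ[ℂ] TensorSq A E} (h : D.IsConnection nabla) :
    D.IsTorsionless nabla ↔ ∀ ω : D.leftInv, D.wedge (nabla ω) = - D.dOne ω := by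
  refine ⟨fun ht ω => eq_neg_of_add_eq_zero_left (LinearMap.congr_fun ht (ω : E)), fun ht => ?_⟩
  ext ρ
  simp only [LinearMap.add_apply, LinearMap.comp_apply, LinearMap.zero_apply]
  induction ρ using Ψ.induction with
  | zero => simp
  | add x y hx hy => simpa only [map_add, add_add_add_comm, hx, hy] using add_zero 0
  | smul a ω =>
    -- The hypothesis on `₀E` makes `-∇ω` a representative of `dω`.
    rw [h, D.isExteriorDerivative_dOne.right_leibniz a ω (-nabla ω) (by simp [ht])]
    simp

include Ψ in
lemma toInvSq_eq {nabla : E →ₗ[ℂ] TensorSq A E} {N : D.leftInv →ₗ[ℂ] D.InvSq}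
    (hN : ∀ ω : D.leftInv, nabla ω = D.invSqMap (N ω)) :
    D.toInvSq (nabla ∘ₗ D.leftInv.subtype) = N := by
  ext ω
  apply Ψ.invSqMap_injective
  have := LinearMap.congr_fun (Ψ.invSqMap_comp_toInvSq (f := nabla ∘ₗ D.leftInv.subtype)
    fun w => ⟨N w, (hN w).symm⟩) ω
  simpa [hN] using this

include Ψ in
-- Since `g(x)` is a scalar for `x ∈ ₀E ⊗ ₀E`, `d(g(x) a) = g(x) da` cancels the last term of
-- `Π̃_g`. What remains is `twist(N)(x) a = 0`, and `a = 1` is the essential case.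
lemma isCompatible_iff (hσ : D.Diagonalisable) {g : TensorSq A E →ₗ[ℂ] A} (hg : D.IsMetric g)
    (hginv : D.IsBiinvariant g) {nabla : E →ₗ[ℂ] TensorSq A E}
    {N : D.leftInv →ₗ[ℂ] D.InvSq} (hN : ∀ ω : D.leftInv, nabla ω = D.invSqMap (N ω)) :
    D.IsCompatible hσ g nabla ↔ D.twist hσ g N = 0 := by
  have hd : ∀ (x : D.InvSq) (a : A),
      D.d (g (D.uTilde x a)) = g (D.invSqMap x) • D.d a := fun x a => by
    rw [uTilde, hg.map_rmul, D.metric_invSqMap hginv, ← Algebra.smul_def, map_smul,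
      algebraMap_smul]
  simp only [IsCompatible, hd, add_eq_right, piInv, Ψ.toInvSq_eq hN]
  refine ⟨fun h => LinearMap.ext fun x => Subtype.ext ?_, fun h => by simp [h]⟩
  simpa using h x 1

end RightTrivialisation

/-! ### The compatibility condition as a linear equation on symmetric tensors. -/

lemma twist_add (hσ : D.Diagonalisable) (g : TensorSq A E →ₗ[ℂ] A)
    (N N' : D.leftInv →ₗ[ℂ] D.InvSq) :
    D.twist hσ g (N + N') = D.twist hσ g N + D.twist hσ g N' := by
  ext x
  simp [twist, LinearMap.rTensor_add]

/-- `twist` is precomposed with the idempotent `psym₀`, whose values are symmetric, so `twist N x =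
twist N (P x)`. -/
lemma twist_eq_zero_iff (Ψ : D.RightTrivialisation) (hσ : D.Diagonalisable)
    (g : TensorSq A E →ₗ[ℂ] A) (N : D.leftInv →ₗ[ℂ] D.InvSq) :
    D.twist hσ g N = 0 ↔ D.twist hσ g N ∘ₗ D.symSq.subtype = 0 := by
  refine ⟨fun h => by rw [h, LinearMap.zero_comp], fun h => LinearMap.ext fun x => ?_⟩
  have hmem : D.psym₀ hσ x ∈ D.symSq := by
    rw [Ψ.symSq_eq_eigenspace]
    exact Submodule.projection_apply_mem hσ.isCompl x
  have hP : D.psym₀ hσ (D.psym₀ hσ x) = D.psym₀ hσ x :=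
    LinearMap.congr_fun (Submodule.isIdempotentElem_projection hσ.isCompl) x
  have := LinearMap.congr_fun h ⟨_, hmem⟩
  simpa [twist, hP] using this

end BicovariantCalculus

end QuantumCalculus

end

/-! ### Existence and uniqueness of the Levi-Civita connection. -/

theorem mainTheorem5 {A : Type*} [Ring A] [HopfAlgebra ℂ A]
    {E : Type*} [AddCommGroup E] [Module ℂ E] [Module A E] [Module Aᵐᵒᵖ E]
    [SMulCommClass A Aᵐᵒᵖ E] [IsScalarTower ℂ A E] [IsScalarTower ℂ Aᵐᵒᵖ E]
    (D : QuantumCalculus.BicovariantCalculus A E)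
    [FiniteDimensional ℂ D.leftInv] [FiniteDimensional ℂ D.rightInv]
    (hσ : D.Diagonalisable)
    (g : QuantumCalculus.TensorSq A E →ₗ[ℂ] A) (hg : D.IsMetric g) (hginv : D.IsBiinvariant g)
    (hΦ : Function.Bijective (D.phi hσ g)) :
    ∃! nabla : E →ₗ[ℂ] QuantumCalculus.TensorSq A E,
      D.IsConnection nabla ∧ D.IsLeftCovariant nabla ∧
        D.IsTorsionless nabla ∧ D.IsCompatible hσ g nabla := by
  obtain ⟨Ψ₀, h₁, h₂⟩ := D.exists_rightTrivialisation hg hginv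
  let Ψ : D.RightTrivialisation := ⟨Ψ₀, h₁, h₂⟩
  obtain ⟨N₀, hN₀⟩ := D.exists_torsionless
  -- `L` is the symmetric correction that cancels the failure of `N₀` to be compatible with `g`;
  -- being symmetric, it does not affect the torsion.
  obtain ⟨L, hL⟩ := hΦ.2 (-(D.twist hσ g N₀ ∘ₗ D.symSq.subtype))
  have hN : ∀ ω : D.leftInv, Ψ.connection (N₀ + D.symSq.subtype ∘ₗ L) (ω : E) =
    D.invSqMap ((N₀ + D.symSq.subtype ∘ₗ L) ω) := Ψ.connection_coe _
  have hc := Ψ.isConnection_connection (N₀ + D.symSq.subtype ∘ₗ L)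
  refine ⟨Ψ.connection (N₀ + D.symSq.subtype ∘ₗ L), ⟨hc, Ψ.isLeftCovariant_connection _,
    (Ψ.isTorsionless_iff hc).2 fun ω => ?_, (Ψ.isCompatible_iff hσ hg hginv hN).2 ?_⟩, ?_⟩
  · have : D.wedge (D.invSqMap (L ω : D.InvSq)) = 0 := LinearMap.mem_ker.1 (L ω).2
    simp [hN, hN₀, this]
  · rw [D.twist_eq_zero_iff Ψ, D.twist_add, LinearMap.add_comp]
    have : D.twist hσ g (D.symSq.subtype ∘ₗ L) ∘ₗ D.symSq.subtype = D.phi hσ g L := rfl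
    rw [this, hL, add_neg_cancel]
  · rintro nabla ⟨hn, hlc, ht, hcomp⟩
    obtain ⟨N, hN'⟩ := Ψ.exists_invSqMap_eq hlc
    rw [Ψ.isTorsionless_iff hn] at ht
    rw [Ψ.isCompatible_iff hσ hg hginv hN'] at hcomp
    -- Both `N` and `N₀` represent `-dω` under `∧`, so their difference lies in `Ker ∧`; injectivity
    -- of `Φ̃_g` then identifies it with `L`.
    have hmem : ∀ ω, (N - N₀) ω ∈ D.symSq := fun ω => by
      change D.wedge (D.invSqMap _) = 0
      rw [LinearMap.sub_apply, map_sub, map_sub, ← hN', ht, hN₀, sub_self]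
    have hNL : D.symSq.subtype ∘ₗ (N - N₀).codRestrict D.symSq hmem = N - N₀ := rfl
    have hadd : N₀ + (N - N₀) = N := add_sub_cancel N₀ N
    have hLN : (N - N₀).codRestrict D.symSq hmem = L := by
      apply hΦ.1
      rw [hL]
      have h₃ : D.phi hσ g ((N - N₀).codRestrict D.symSq hmem) =
          D.twist hσ g (N - N₀) ∘ₗ D.symSq.subtype := rfl
      have h₄ := D.twist_add hσ g N₀ (N - N₀)
      rw [hadd, hcomp] at h₄
      rw [h₃, eq_neg_iff_add_eq_zero, ← LinearMap.add_comp, add_comm, ← h₄, LinearMap.zero_comp]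
    refine Ψ.connection_ext hn hc fun ω => ?_
    rw [hN', hN, ← hLN, hNL, hadd]
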